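/- Let $G$ be a finite group with exponent $n_1=2^m p_1^{m_1}\cdots p_r^{m_r}$ ($p_1,\dots,p_r$ the distinct odd prime divisors, $m\ge 0$, $m_j\ge 1$). Let $\mathcal D$ be the set of integers of the form $$\Delta=2^{w_0}(-1)^w\big((-1)^{(p_1-1)/2}p_1\big)^{w_1}\cdots\big((-1)^{(p_r-1)/2}p_r\big)^{w_r},\qquad(\ast)$$ with $w,w_0,w_1,\dots,w_r\in\{0,1\}$, $w_0=0$ if $m<3$, and $w=0$ if $m<2$. The integer $\Delta$ determines these exponents, and we put $$H_\Delta=\Big\{k\in\mathbb Z_{n_1}^*\ :\ \chi(k)^{w_0}\,\chi_4(k)^{w}\,\Big(\tfrac{k}{p_1}\Big)^{w_1}\cdots\Big(\tfrac{k}{p_r}\Big)^{w_r}=1\Big\},$$ where $\chi(k)=1$ if $k\equiv 1,7$ and $\chi(k)=-1$ if $k\equiv 3,5\pmod 8$, $\chi_4(k)=1$ if $k\equiv 1$ and $\chi_4(k)=-1$ if $k\equiv 3\pmod 4$, and $\big(\tfrac{k}{p}\big)$ is the Legendre symbol. For $g,h\in G$ write $g\sim_\Delta h$ if $g$ and $h^k$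 are conjugate in $G$ for some $k\in H_\Delta$; this is an equivalence relation. For $C\subseteq G$ write $C^k=\{g^k: g\in C\}$ and $C^{-1}=\{g^{-1}:g\in C\}$. Let $C(i),C(1),C(-1)\subseteq G$ be unions of conjugacy classes such that $C(i),C(i)^{-1},C(1),C(-1)$ are pairwise disjoint, $C(1)^{-1}=C(1)$, $C(-1)^{-1}=C(-1)$ and $1\notin C(1)\cup C(-1)$. Let $X=X(G,C(i),C(1),C(-1))$ be the weighted normal Cayley graph with Hermitian matrix $M$, indexed by $G$, where $M_{a,b}$ equals $i,-i,1,-1$ if $ba^{-1}$ lies in $C(i),C(i)^{-1},C(1),C(-1)$, respectively, and $M_{a,b}=0$ otherwise. Let $U(t)=\exp(itM)$. The continuous quantum walk on $X$ is periodic at a vertex $a$ at time $t$ if $U(t)e_a=\alpha e_a$ for some $\alpha\in\mathbb C$. Then the following are equivalent. 1. The walk on $X$ is periodic at some vertex at some time $t>0$. 2. There is a time $t>0$ at which the walk on $X$ is periodic at every vertex. 3. For some $\Delta\in\mathcal D$, all of the following hold: * if $-|\Delta|\in\mathcal D$, then $C(i)$ is a union of $\sim_{-|\Delta|}$ equivalence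 classes; if $-|\Delta|\notin\mathcal D$, then $C(i)=\emptyset$; * if $|\Delta|\in\mathcal D$, then $C(1)$ and $C(-1)$ are unions of $\sim_{|\Delta|}$ equivalence classes and, if moreover $\Delta\ne 1$, $C(1)=C(-1)^k$ for some $k\in\mathbb Z_{n_1}^*\setminus H_{|\Delta|}$; if $|\Delta|\notin\mathcal D$, then $C(1)=C(-1)=\emptyset$. Moreover, "for some $k$" may be replaced by "for any $k$" here: if $\Delta\in\mathcal D$, $\Delta>0$, $\Delta\neq1$, and $C(1)$ and $C(-1)$ are unions of $\sim_\Delta$ equivalence classes, then $C(1)=C(-1)^k$ for some $k\in\mathbb Z_{n_1}^*\setminus H_\Delta$ if and only if $C(1)=C(-1)^k$ for every $k\in\mathbb Z_{n_1}^*\setminus H_\Delta$. -/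

import Mathlib

open scoped Pointwise

namespace CayleyWalk

/-- Exponents `w₀`, `w` and `w_p` (for the odd primes `p ∣ n`), each `0` or `1`, such that `w₀ = 0`
if the exponent of `2` in `n` is less than `3` and `w = 0` if it is less than `2`.
The values of `wp` outside the odd prime divisors of `n` are never used. -/
structure DeltaExponents (n : ℕ) where
  w₀ : Fin 2
  w : Fin 2
  wp : ℕ → Fin 2
  w₀_eq_zero : n.factorization 2 < 3 → w₀ = 0
  w_eq_zero : n.factorization 2 < 2 → w = 0

/-- The odd prime divisors of `n`. -/
def oddPrimes (n : ℕ) : Finset ℕ := n.primeFactors.erase 2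

/-- `2^{w₀} (-1)^w ∏_p ((-1)^{(p-1)/2} p)^{w_p}`, the product over the odd prime divisors of `n`. -/
def DeltaExponents.delta {n : ℕ} (e : DeltaExponents n) : ℤ :=
  2 ^ (e.w₀ : ℕ) * (-1) ^ (e.w : ℕ) *
    ∏ p ∈ oddPrimes n, ((-1) ^ ((p - 1) / 2) * (p : ℤ)) ^ (e.wp p : ℕ)

/-- `χ(k)^{w₀} (k/4)^w ∏_p (k/p)^{w_p}` for a unit `k` modulo `n`. Here `ZMod.χ₈` is `1` at `1, 7`
and `-1` at `3, 5`, `ZMod.χ₄` is `1` at `1` and `-1` at `3`, and the symbol at a prime `p` is the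
Legendre symbol. -/
def DeltaExponents.symbol {n : ℕ} (e : DeltaExponents n) (k : (ZMod n)ˣ) : ℤ :=
  ZMod.χ₈ ((k : ZMod n).val : ZMod 8) ^ (e.w₀ : ℕ) *
    ZMod.χ₄ ((k : ZMod n).val : ZMod 4) ^ (e.w : ℕ) *
    ∏ p ∈ oddPrimes n, jacobiSym ((k : ZMod n).val : ℤ) p ^ (e.wp p : ℕ)

/-- `Δ` is one of the finitely many integers attached to `n`. -/
def IsDelta (n : ℕ) (Δ : ℤ) : Prop := ∃ e : DeltaExponents n, e.delta = Δ

/-- The subgroup `H_Δ` of the units modulo `n`, as a set. For an integer `Δ` with `IsDelta n Δ`,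
the relevant exponents are determined by `Δ`; it is only used for such `Δ`. -/
def H (n : ℕ) (Δ : ℤ) : Set (ZMod n)ˣ :=
  {k | ∃ e : DeltaExponents n, e.delta = Δ ∧ e.symbol k = 1}

variable {G : Type*} [Group G]

/-- `C^k = {g^k | g ∈ C}` for a unit `k` modulo the exponent of the group. -/
def powSet (C : Set G) (k : (ZMod (Monoid.exponent G))ˣ) : Set G :=
  (fun g => g ^ (k : ZMod (Monoid.exponent G)).val) '' C

/-- `g ∼_Δ h` iff `g` and `h^k` are conjugate for some `k ∈ H_Δ`. -/
def DeltaRel (Δ : ℤ) (g h : G) : Prop :=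
  ∃ k ∈ H (Monoid.exponent G) Δ, IsConj g (h ^ (k : ZMod (Monoid.exponent G)).val)

/-- `C` is a union of (possibly no) equivalence classes of `∼_Δ`. -/
def IsUnionOfClasses (Δ : ℤ) (C : Set G) : Prop :=
  ∃ S : Set G, C = ⋃ h ∈ S, {g | DeltaRel Δ g h}

/-- `C` is a union of conjugacy classes. -/
def IsNormalSet (C : Set G) : Prop := ∀ g ∈ C, ∀ x : G, x * g * x⁻¹ ∈ C

/-- `Ci`, `C1`, `Cm` are the connection sets `C(i)`, `C(1)`, `C(-1)` of a normal Cayley graph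
weighted by fourth roots of unity: the oriented Cayley graph on `C(i)` together with the
(loopless, undirected) signed Cayley graph on `C(1)`, `C(-1)`. -/
structure IsNormalMixed (Ci C1 Cm : Set G) : Prop where
  normal_i : IsNormalSet Ci
  normal_one : IsNormalSet C1
  normal_neg : IsNormalSet Cm
  inv_one : C1⁻¹ = C1
  inv_neg : Cm⁻¹ = Cm
  one_notMem_one : (1 : G) ∉ C1
  one_notMem_neg : (1 : G) ∉ Cm
  disj_i_inv : Disjoint Ci Ci⁻¹
  disj_i_one : Disjoint Ci C1
  disj_i_neg : Disjoint Ci Cm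
  disj_inv_one : Disjoint Ci⁻¹ C1
  disj_inv_neg : Disjoint Ci⁻¹ Cm
  disj_one_neg : Disjoint C1 Cm

/-- The `(0,1)`-matrix `A_C` with `(A_C)_{a,b} = 1` iff `b a⁻¹ ∈ C`. -/
noncomputable def cayleyMatrix (C : Set G) : Matrix G G ℂ :=
  Matrix.of fun a b => C.indicator (fun _ => (1 : ℂ)) (b * a⁻¹)

/-- The matrix with weights `i`, `-i`, `1`, `-1` on `C(i)`, `C(i)⁻¹`, `C(1)`, `C(-1)`. -/
noncomputable def mixedMatrix (Ci C1 Cm : Set G) : Matrix G G ℂ :=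
  Complex.I • (cayleyMatrix Ci - cayleyMatrix Ci⁻¹) + cayleyMatrix C1 - cayleyMatrix Cm

/-- The transition matrix `U(t) = exp(i t M)` of the continuous quantum walk relative to `M`. -/
noncomputable def transition {V : Type*} [Fintype V] [DecidableEq V] (M : Matrix V V ℂ) (t : ℝ) :
    Matrix V V ℂ :=
  NormedSpace.exp ((Complex.I * (t : ℂ)) • M)

/-- The walk relative to `M` is periodic at the vertex `a` at time `t`. -/
def PeriodicAt {V : Type*} [Fintype V] [DecidableEq V] (M : Matrix V V ℂ) (a : V) (t : ℝ) : Prop :=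
  ∃ α : ℂ, Matrix.mulVec (transition M t) (Pi.single a 1) = α • (Pi.single a 1 : V → ℂ)

end CayleyWalk

/-! Write `M = A + B`, where `A` is the group matrix of `f = 1_{C(1)} - 1_{C(-1)}` and `B` is `i`
times that of `h = 1_{C(i)} - 1_{C(i)⁻¹}`. Both are Hermitian, they commute, and `Mᵀ = A - B`.

Since `M` is invariant under right translation, periodicity at one vertex makes `U(t)` a scalar.
Multiplying by the exponential for `Mᵀ`, or by its inverse, shows that `exp(2itA)` and `exp(2itB)`
are scalar. As `A` and `B` have trace zero, all their eigenvalues are rational multiples of `π/t`.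
The squares of these eigenvalues sum to an integer, so unless all vanish `(π/t)²` is rational, and
all eigenvalues lie in `ℚ√d` for one squarefree `d`. Conversely, if they lie in `ℚ√d`, a multiple of
`2π/√d` is a period.

It remains to decide when the eigenvalues lie in `ℚ√d`. Spectral projections of `A` and `B` are
central, so they can replace irreducible characters: the traces of group elements against them are
sums of roots of unity, and `ζ ↦ ζ^K` moves the trace at `g` to that at `g^K`. Hence the eigenvalues
of `A` lie in `ℚ√d` exactly when `f(g^K) = ψ(K) f(g)`, with `ψ` the character by which the Galois
group acts on `√d`; for `B` the root is that of `-d`, because `i√(-d)` is real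
(`eigenvalues_of_forall_apply_pow`, `apply_pow_of_eigenvalues`).

Explicit roots (`i`, `√2`, Gauss sums) identify `ψ` with the symbol of `Δ = ±d`. This is first done
modulo a large multiple of the exponent; on passing back, either `Δ` belongs to the exponent or the
function vanishes (`transformsBy_of_eigenvalues`). The transformation rule is then rewritten as the
condition on classes. -/

namespace CayleyWalk

/-! ### Spectral projections and traces of idempotents -/

open Polynomial in
/-- The spectral projection of `X` at `a`, for an element `X` annihilated by `∏_{b ∈ S} (T - b)`. -/
noncomputable def specProj {F A : Type*} [Field F] [DecidableEq F] [Ring A] [Algebra F A]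
    (S : Finset F) (X : A) (a : F) : A :=
  aeval X (Lagrange.basis S id a)

section SpecProj

open Polynomial

variable {F A : Type*} [Field F] [DecidableEq F] [Ring A] [Algebra F A] {S : Finset F} {X : A}

theorem sum_specProj (hS : S.Nonempty) : ∑ a ∈ S, specProj S X a = 1 := by
  unfold specProj
  rw [← map_sum, Lagrange.sum_basis (Function.injective_id.injOn) hS, map_one]

theorem nodal_dvd_mul_basis {a : F} (ha : a ∈ S) :
    Lagrange.nodal S id ∣ (Polynomial.X - C a) * Lagrange.basis S id a := by
  have : Lagrange.basis S id a = C (∏ j ∈ S.erase a, (a - j)⁻¹) * Lagrange.nodal (S.erase a) id := by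
    simp only [Lagrange.basis, Lagrange.basisDivisor, Lagrange.nodal_eq, Finset.prod_mul_distrib,
      map_prod, id]
  rw [this, Lagrange.nodal_eq_mul_nodal_erase ha]
  exact ⟨C (∏ j ∈ S.erase a, (a - j)⁻¹), by simp only [id]; ring⟩

theorem mul_specProj (h : aeval X (Lagrange.nodal S id) = 0) {a : F} (ha : a ∈ S) :
    X * specProj S X a = a • specProj S X a := by
  obtain ⟨q, hq⟩ := nodal_dvd_mul_basis ha
  have := congrArg (aeval X) hq
  rw [map_mul, map_mul, h, zero_mul, map_sub, aeval_X, aeval_C, sub_mul, sub_eq_zero,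
    ← Algebra.smul_def] at this
  exact this

theorem aeval_mul_specProj (h : aeval X (Lagrange.nodal S id) = 0) {a : F} (ha : a ∈ S)
    (p : F[X]) : aeval X p * specProj S X a = p.eval a • specProj S X a := by
  obtain ⟨q, hq⟩ := X_sub_C_dvd_sub_C_eval (a := a) (p := p)
  have := congrArg (aeval X) hq
  rw [map_sub, aeval_C, sub_eq_iff_eq_add, mul_comm, map_mul, map_sub, aeval_X, aeval_C] at this
  rw [this, add_mul, mul_assoc, sub_mul, mul_specProj h ha, ← Algebra.smul_def, sub_self, mul_zero,
    zero_add, ← Algebra.smul_def]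

theorem pow_mul_specProj (h : aeval X (Lagrange.nodal S id) = 0) {a : F} (ha : a ∈ S) (m : ℕ) :
    X ^ m * specProj S X a = a ^ m • specProj S X a := by
  simpa using aeval_mul_specProj h ha (Polynomial.X ^ m)

theorem isIdempotentElem_specProj (h : aeval X (Lagrange.nodal S id) = 0) {a : F} (ha : a ∈ S) :
    IsIdempotentElem (specProj S X a) := by
  have := aeval_mul_specProj h ha (Lagrange.basis S id a)
  rwa [show eval a (Lagrange.basis S id a) = 1 from
    Lagrange.eval_basis_self (v := id) (Function.injective_id.injOn) ha, one_smul] at this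

theorem commute_specProj {Y : A} (h : Commute Y X) (a : F) : Commute Y (specProj S X a) := by
  unfold specProj
  generalize Lagrange.basis S id a = p
  induction p using Polynomial.induction_on' with
  | add p q hp hq => rw [map_add]; exact hp.add_right hq
  | monomial n c =>
    rw [aeval_monomial]
    exact Commute.mul_right (Algebra.commutes c Y).symm (h.pow_right n)

end SpecProj

section Trace

variable {V : Type*} [Fintype V] [DecidableEq V]

theorem isIdempotentElem_toLin' {P : Matrix V V ℂ} (hP : IsIdempotentElem P) :
    IsIdempotentElem (Matrix.toLin' P) :=
  hP.map (Matrix.toLinAlgEquiv' : Matrix V V ℂ ≃ₐ[ℂ] _)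

theorem exists_natCast_eq_trace {P : Matrix V V ℂ} (hP : IsIdempotentElem P) :
    ∃ r : ℕ, P.trace = r :=
  ⟨_, by
    rw [← Matrix.trace_toLin'_eq]
    exact (LinearMap.IsIdempotentElem.isProj_range _ (isIdempotentElem_toLin' hP)).trace⟩

theorem eq_zero_of_trace_eq_zero {P : Matrix V V ℂ} (hP : IsIdempotentElem P) (h : P.trace = 0) :
    P = 0 := by
  rw [← Matrix.trace_toLin'_eq,
    LinearMap.IsIdempotentElem.trace_eq_zero_iff (isIdempotentElem_toLin' hP)] at h
  exact Matrix.toLin'.map_eq_zero_iff.1 h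

open Polynomial in
/-- The traces of the powers of a matrix of finite order, compressed by a commuting idempotent, are
sums of powers of roots of unity. -/
theorem exists_trace_pow_mul_eq_sum {N : ℕ} (hN : 0 < N) {ζ : ℂ} (hζ : IsPrimitiveRoot ζ N)
    {P X : Matrix V V ℂ} (hP : IsIdempotentElem P) (hX : X ^ N = 1) (hc : Commute P X) :
    ∃ r : ℕ → ℕ, ∀ m : ℕ,
      (X ^ m * P).trace = ∑ j ∈ Finset.range N, (r j : ℂ) * ζ ^ (j * m) := by
  classical
  set S : Finset ℂ := (Finset.range N).image (ζ ^ ·) with hS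
  have hinj : Set.InjOn (ζ ^ ·) (Finset.range N : Set ℕ) := fun i hi j hj hij =>
    hζ.pow_inj (by simpa using hi) (by simpa using hj) hij
  have hnod : aeval X (Lagrange.nodal S id) = 0 := by
    have : Lagrange.nodal S id = Polynomial.X ^ N - 1 := by
      have h := X_pow_sub_one_eq_prod hN hζ
      rw [h, Lagrange.nodal_eq]
      refine Finset.prod_congr ?_ fun _ _ => rfl
      ext z
      rw [mem_nthRootsFinset hN, hS, Finset.mem_image]
      constructor
      · rintro ⟨i, -, rfl⟩
        rw [← pow_mul, mul_comm, pow_mul, hζ.pow_eq_one, one_pow]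
      · intro hz
        have : NeZero N := ⟨hN.ne'⟩
        obtain ⟨i, hi, rfl⟩ := hζ.eq_pow_of_pow_eq_one hz
        exact ⟨i, Finset.mem_range.2 hi, rfl⟩
    rw [this, map_sub, map_pow, aeval_X, map_one, hX, sub_self]
  have hne : S.Nonempty := ⟨1, Finset.mem_image.2 ⟨0, Finset.mem_range.2 hN, pow_zero _⟩⟩
  have key : ∀ j, ∃ r : ℕ, j ∈ Finset.range N → (specProj S X (ζ ^ j) * P).trace = r := by
    intro j
    by_cases hj : j ∈ Finset.range N
    · have hid := isIdempotentElem_specProj hnod (Finset.mem_image_of_mem (ζ ^ ·) hj)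
      obtain ⟨r, hr⟩ := exists_natCast_eq_trace
        (IsIdempotentElem.mul_of_commute (commute_specProj hc _).symm hid hP)
      exact ⟨r, fun _ => hr⟩
    · exact ⟨0, fun h => absurd h hj⟩
  choose r hr using key
  refine ⟨r, fun m => ?_⟩
  calc (X ^ m * P).trace = (X ^ m * (∑ a ∈ S, specProj S X a) * P).trace := by
        rw [sum_specProj hne, mul_one]
    _ = ∑ j ∈ Finset.range N, (X ^ m * specProj S X (ζ ^ j) * P).trace := by
        rw [hS, Finset.sum_image hinj, Finset.mul_sum, Finset.sum_mul, Matrix.trace_sum]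
    _ = _ := by
        refine Finset.sum_congr rfl fun j hj => ?_
        rw [pow_mul_specProj hnod (Finset.mem_image_of_mem (ζ ^ ·) hj), smul_mul_assoc,
          Matrix.trace_smul, hr j hj, smul_eq_mul, mul_comm, ← pow_mul]

end Trace

/-! ### Polynomials and exponentials of Hermitian matrices -/

section Hermitian

open Polynomial

variable {V : Type*} [Fintype V] [DecidableEq V] {A : Matrix V V ℂ}

theorem aeval_of_isHermitian (hA : A.IsHermitian) (p : ℂ[X]) :
    aeval A p = Unitary.conjStarAlgAut ℂ (Matrix V V ℂ) hA.eigenvectorUnitary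
      (Matrix.diagonal fun i => p.eval (hA.eigenvalues i : ℂ)) := by
  have h1 := aeval_algHom_apply
    (Unitary.conjStarAlgAut ℂ (Matrix V V ℂ) hA.eigenvectorUnitary).toAlgEquiv.toAlgHom
    (Matrix.diagonal (RCLike.ofReal ∘ hA.eigenvalues)) p
  have h2 := aeval_algHom_apply (Matrix.diagonalAlgHom ℂ (n := V) (α := ℂ))
    (RCLike.ofReal ∘ hA.eigenvalues) p
  have h3 : aeval (RCLike.ofReal ∘ hA.eigenvalues : V → ℂ) p =
      fun i => p.eval (hA.eigenvalues i : ℂ) := by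
    ext i
    exact (aeval_algHom_apply (Pi.evalAlgHom ℂ (fun _ : V => ℂ) i)
      (RCLike.ofReal ∘ hA.eigenvalues) p).symm.trans (by simp [coe_aeval_eq_eval])
  rw [h3] at h2
  conv_lhs => rw [hA.spectral_theorem]
  exact h1.trans (congrArg _ h2)

theorem aeval_eq_zero_iff_of_isHermitian (hA : A.IsHermitian) (p : ℂ[X]) :
    aeval A p = 0 ↔ ∀ i, p.eval (hA.eigenvalues i : ℂ) = 0 := by
  rw [aeval_of_isHermitian hA, EmbeddingLike.map_eq_zero_iff, Matrix.diagonal_eq_zero]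
  exact funext_iff

theorem trace_aeval_of_isHermitian (hA : A.IsHermitian) (p : ℂ[X]) :
    (aeval A p).trace = ∑ i, p.eval (hA.eigenvalues i : ℂ) := by
  rw [aeval_of_isHermitian hA, Unitary.conjStarAlgAut_apply, Matrix.trace_mul_comm, ← mul_assoc,
    Unitary.coe_star_mul_self, one_mul, Matrix.trace_diagonal]

theorem exp_smul_of_isHermitian (hA : A.IsHermitian) (c : ℂ) :
    NormedSpace.exp (c • A) = (hA.eigenvectorUnitary : Matrix V V ℂ) *
      Matrix.diagonal (fun i => Complex.exp (c * hA.eigenvalues i)) *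
      star (hA.eigenvectorUnitary : Matrix V V ℂ) := by
  conv_lhs => rw [hA.spectral_theorem]
  rw [Unitary.conjStarAlgAut_apply, ← smul_mul_assoc, ← mul_smul_comm]
  have := Matrix.exp_units_conj (Unitary.toUnits hA.eigenvectorUnitary)
    (c • Matrix.diagonal (RCLike.ofReal ∘ hA.eigenvalues))
  refine this.trans ?_
  rw [← Matrix.diagonal_smul, Matrix.exp_diagonal]
  congr 3
  ext i
  rw [Complex.exp_eq_exp_ℂ, Pi.coe_exp]
  simp

theorem exp_smul_eq_one_of_isHermitian (hA : A.IsHermitian) (c : ℂ)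
    (h : ∀ i, Complex.exp (c * hA.eigenvalues i) = 1) : NormedSpace.exp (c • A) = 1 := by
  rw [exp_smul_of_isHermitian hA]
  simp [h]

theorem exp_eigenvalue_eq_of_exp_smul_eq_smul_one (hA : A.IsHermitian) {c α : ℂ}
    (h : NormedSpace.exp (c • A) = α • (1 : Matrix V V ℂ)) (i : V) :
    Complex.exp (c * hA.eigenvalues i) = α := by
  rw [exp_smul_of_isHermitian hA] at h
  have h2 := congrArg (fun Y => star (hA.eigenvectorUnitary : Matrix V V ℂ) * Y *
    (hA.eigenvectorUnitary : Matrix V V ℂ)) h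
  have hU : star (hA.eigenvectorUnitary : Matrix V V ℂ) * hA.eigenvectorUnitary = 1 :=
    Unitary.coe_star_mul_self _
  simp only [mul_smul_comm, smul_mul_assoc, mul_one, hU] at h2
  rw [← mul_assoc, ← mul_assoc, hU, one_mul, mul_assoc, hU, mul_one] at h2
  simpa using congrFun (congrFun h2 i) i

end Hermitian

/-! ### Quadratic irrationalities in cyclotomic fields -/

section Galois

variable {N : ℕ} [NeZero N]

instance isCyclotomicExtension_rat (N : ℕ) [NeZero N] :
    IsCyclotomicExtension {N} ℚ (CyclotomicField N ℚ) :=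
  CyclotomicField.isCyclotomicExtension _ _

/-- The automorphism `ζ ↦ ζ ^ K` of the `N`-th cyclotomic field. -/
noncomputable def cycAut (K : (ZMod N)ˣ) : CyclotomicField N ℚ ≃ₐ[ℚ] CyclotomicField N ℚ :=
  (IsCyclotomicExtension.Rat.galEquivZMod N (CyclotomicField N ℚ)).symm K

theorem cycAut_apply (K : (ZMod N)ˣ) {x : CyclotomicField N ℚ} (hx : x ^ N = 1) :
    cycAut K x = x ^ (K : ZMod N).val := by
  have := IsCyclotomicExtension.Rat.galEquivZMod_apply_of_pow_eq N (CyclotomicField N ℚ)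
    (cycAut K) hx
  rwa [cycAut, MulEquiv.apply_symm_apply] at this

theorem cycAut_mul (K K' : (ZMod N)ˣ) (x : CyclotomicField N ℚ) :
    cycAut (K * K') x = cycAut K (cycAut K' x) := by
  simp only [cycAut, map_mul]; rfl

theorem exists_rat_of_forall_cycAut_eq {x : CyclotomicField N ℚ}
    (h : ∀ K : (ZMod N)ˣ, cycAut K x = x) : ∃ q : ℚ, x = algebraMap ℚ (CyclotomicField N ℚ) q := by
  have := IsCyclotomicExtension.isGalois {N} ℚ (CyclotomicField N ℚ)
  have hx : x ∈ (⊥ : IntermediateField ℚ (CyclotomicField N ℚ)) := by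
    rw [IsGalois.mem_bot_iff_fixed]
    intro σ
    have := h (IsCyclotomicExtension.Rat.galEquivZMod N (CyclotomicField N ℚ) σ)
    rwa [cycAut, MulEquiv.symm_apply_apply] at this
  obtain ⟨q, hq⟩ := IntermediateField.mem_bot.1 hx
  exact ⟨q, hq.symm⟩

/-- `a` has a square root in the `N`-th cyclotomic field on which the Galois group acts
through `ψ`. -/
def HasSqrtWith (N : ℕ) [NeZero N] (a : ℤ) (ψ : (ZMod N)ˣ → ℤ) : Prop :=
  ∃ s : CyclotomicField N ℚ, s ^ 2 = a ∧ ∀ K : (ZMod N)ˣ, cycAut K s = ψ K * s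

theorem HasSqrtWith.one : HasSqrtWith N 1 fun _ => 1 := ⟨1, by simp, by simp⟩

theorem HasSqrtWith.mul {a b : ℤ} {ψ φ : (ZMod N)ˣ → ℤ} (ha : HasSqrtWith N a ψ)
    (hb : HasSqrtWith N b φ) : HasSqrtWith N (a * b) fun K => ψ K * φ K := by
  obtain ⟨s, hs, hs'⟩ := ha
  obtain ⟨t, ht, ht'⟩ := hb
  refine ⟨s * t, by rw [mul_pow, hs, ht]; push_cast; ring, fun K => ?_⟩
  rw [map_mul, hs', ht']
  push_cast
  ring

theorem HasSqrtWith.pow_fin_two {a : ℤ} {ψ : (ZMod N)ˣ → ℤ} (w : Fin 2)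
    (h : w ≠ 0 → HasSqrtWith N a ψ) : HasSqrtWith N (a ^ (w : ℕ)) fun K => ψ K ^ (w : ℕ) := by
  match w, h with
  | 0, _ => simpa using HasSqrtWith.one
  | 1, h => simpa using h one_ne_zero

theorem HasSqrtWith.prod {ι : Type*} (S : Finset ι) {a : ι → ℤ} {ψ : ι → (ZMod N)ˣ → ℤ}
    (h : ∀ i ∈ S, HasSqrtWith N (a i) (ψ i)) :
    HasSqrtWith N (∏ i ∈ S, a i) fun K => ∏ i ∈ S, ψ i K := by
  classical
  induction S using Finset.induction_on with
  | empty => simpa using HasSqrtWith.one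
  | insert i S hi ih =>
    simp only [Finset.prod_insert hi]
    exact (h i (Finset.mem_insert_self i S)).mul
      (ih fun j hj => h j (Finset.mem_insert_of_mem hj))

theorem exists_isPrimitiveRoot_cycAut {m : ℕ} (hm : m ∣ N) :
    ∃ ζ : CyclotomicField N ℚ, IsPrimitiveRoot ζ m ∧
      ∀ K : (ZMod N)ˣ, cycAut K ζ = ζ ^ (K : ZMod N).val := by
  obtain ⟨c, hc⟩ := hm
  have hζ := IsCyclotomicExtension.zeta_spec N ℚ (CyclotomicField N ℚ)
  have h2 := hζ.pow (NeZero.pos N) (a := c) (b := m) (by rw [hc, mul_comm])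
  exact ⟨_, h2, fun K => cycAut_apply K (by
    rw [← pow_mul, mul_comm, pow_mul, hζ.pow_eq_one, one_pow])⟩

theorem hasSqrtWith_neg_one (h : 4 ∣ N) :
    HasSqrtWith N (-1) fun K => ZMod.χ₄ ((K : ZMod N).val : ZMod 4) := by
  obtain ⟨ζ, hζ, hK⟩ := exists_isPrimitiveRoot_cycAut h
  have h2 : ζ ^ 2 = -1 := by
    have := hζ.pow (by norm_num) (show 4 = 2 * 2 by norm_num)
    exact this.eq_neg_one_of_two_right
  have h4 : ζ ^ 4 = 1 := hζ.pow_eq_one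
  refine ⟨ζ, by simpa using h2, fun K => ?_⟩
  rw [hK]
  have hodd : Nat.Coprime (K : ZMod N).val 4 := Nat.Coprime.coprime_dvd_right h
    (ZMod.val_coe_unit_coprime K)
  beta_reduce
  generalize (K : ZMod N).val = v at hodd ⊢
  have hv : v % 4 = 1 ∨ v % 4 = 3 := by
    have : v % 2 = 1 := Nat.odd_iff.1 (Nat.coprime_two_right.1
      (Nat.Coprime.coprime_dvd_right (by norm_num : 2 ∣ 4) hodd))
    omega
  rw [← ZMod.natCast_mod v 4, ← pow_mod_orderOf ζ v, ← hζ.eq_orderOf]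
  rcases hv with hv | hv <;> rw [hv]
  · rw [show ZMod.χ₄ ((1 : ℕ) : ZMod 4) = 1 from by decide]; push_cast; ring
  · rw [show ZMod.χ₄ ((3 : ℕ) : ZMod 4) = -1 from by decide]
    rw [show ζ ^ 3 = ζ ^ 2 * ζ by ring, h2]; simp

theorem hasSqrtWith_two (h : 8 ∣ N) :
    HasSqrtWith N 2 fun K => ZMod.χ₈ ((K : ZMod N).val : ZMod 8) := by
  obtain ⟨ζ, hζ, hK⟩ := exists_isPrimitiveRoot_cycAut h
  have h4 : ζ ^ 4 = -1 := by
    have := hζ.pow (by norm_num) (show 8 = 4 * 2 by norm_num)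
    exact this.eq_neg_one_of_two_right
  have h8 : ζ ^ 8 = 1 := hζ.pow_eq_one
  -- This is `ζ + ζ⁻¹` for a primitive eighth root of unity; the cross term gives 2 and `ζ² + ζ⁻² =
  -- 0`.
  refine ⟨ζ + ζ ^ 7, ?_, fun K => ?_⟩
  · push_cast
    linear_combination (ζ ^ 2 + ζ ^ 6 * (ζ ^ 4 - 1)) * h4 + 2 * h8
  rw [map_add, map_pow, hK]
  have hodd : Nat.Coprime (K : ZMod N).val 8 := Nat.Coprime.coprime_dvd_right h
    (ZMod.val_coe_unit_coprime K)
  beta_reduce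
  generalize (K : ZMod N).val = v at hodd ⊢
  have hv : v % 8 = 1 ∨ v % 8 = 3 ∨ v % 8 = 5 ∨ v % 8 = 7 := by
    have : v % 2 = 1 := Nat.odd_iff.1 (Nat.coprime_two_right.1
      (Nat.Coprime.coprime_dvd_right (by norm_num : 2 ∣ 8) hodd))
    omega
  rw [← ZMod.natCast_mod v 8, ← pow_mod_orderOf ζ v, ← hζ.eq_orderOf]
  rcases hv with hv | hv | hv | hv <;> rw [hv]
  · rw [show ZMod.χ₈ ((1 : ℕ) : ZMod 8) = 1 from by decide]; push_cast; ring
  · rw [show ZMod.χ₈ ((3 : ℕ) : ZMod 8) = -1 from by decide]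
    push_cast
    linear_combination (ζ ^ 13 + ζ ^ 5) * h8 + (ζ + ζ ^ 3) * h4
  · rw [show ZMod.χ₈ ((5 : ℕ) : ZMod 8) = -1 from by decide]
    push_cast
    linear_combination (ζ ^ 27 + ζ ^ 19 + ζ ^ 11 + ζ ^ 3) * h8 + (ζ + ζ ^ 3) * h4
  · rw [show ZMod.χ₈ ((7 : ℕ) : ZMod 8) = 1 from by decide]
    push_cast
    linear_combination (ζ ^ 41 + ζ ^ 33 + ζ ^ 25 + ζ ^ 17 + ζ ^ 9 + ζ) * h8

/-- The root is the quadratic Gauss sum: the automorphism fixes the values of the quadratic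
character and only shifts the additive character, which multiplies the sum by the Legendre symbol.
-/
theorem hasSqrtWith_prime {p : ℕ} (hp : p.Prime) (hp2 : p ≠ 2) (h : p ∣ N) :
    HasSqrtWith N ((-1) ^ ((p - 1) / 2) * (p : ℤ))
      fun K => jacobiSym ((K : ZMod N).val : ℤ) p := by
  have : Fact p.Prime := ⟨hp⟩
  obtain ⟨ζ, hζ, hK⟩ := exists_isPrimitiveRoot_cycAut h
  set χ : MulChar (ZMod p) (CyclotomicField N ℚ) :=
    (quadraticChar (ZMod p)).ringHomComp (Int.castRingHom _) with hχ
  set ψ := AddChar.zmodChar p hζ.pow_eq_one with hψ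
  have hprim : ψ.IsPrimitive := AddChar.zmodChar_primitive_of_primitive_root p hζ
  have hχ1 : χ ≠ 1 := by
    rw [hχ, Ne, MulChar.ringHomComp_eq_one_iff Int.cast_injective]
    exact quadraticChar_ne_one (by rwa [ZMod.ringChar_zmod_n])
  have hχ2 : χ.IsQuadratic := (quadraticChar_isQuadratic (ZMod p)).comp _
  refine ⟨gaussSum χ ψ, ?_, fun K => ?_⟩
  · rw [gaussSum_sq hχ1 hχ2 hprim]
    rw [ZMod.card]
    have h1 : χ (-1) = ((legendreSym p (-1) : ℤ) : CyclotomicField N ℚ) := by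
      simp [hχ, legendreSym]
    rw [h1, legendreSym.at_neg_one hp2, ZMod.χ₄_eq_neg_one_pow (hp.eq_two_or_odd.resolve_left hp2)]
    have h2 : p / 2 = (p - 1) / 2 := by
      have := hp.eq_two_or_odd.resolve_left hp2
      omega
    rw [h2]
    push_cast
    ring
  · beta_reduce
    have hcop : IsUnit (((K : ZMod N).val : ℕ) : ZMod p) :=
      (ZMod.isUnit_iff_coprime _ _).2 (Nat.Coprime.coprime_dvd_right h (ZMod.val_coe_unit_coprime K))
    have h1 : cycAut K (gaussSum χ ψ) = gaussSum χ (ψ.mulShift hcop.unit) := by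
      simp only [gaussSum, map_sum, map_mul]
      refine Finset.sum_congr rfl fun a _ => ?_
      congr 1
      · simp [hχ]
      · rw [AddChar.mulShift_apply, AddChar.zmodChar_apply, map_pow, hK, IsUnit.unit_spec,
          ← ZMod.natCast_zmod_val a, ← Nat.cast_mul, AddChar.zmodChar_apply', ← pow_mul,
          ZMod.natCast_zmod_val]
    have h2 := gaussSum_mulShift χ ψ hcop.unit
    have h3 : χ hcop.unit = ((jacobiSym ((K : ZMod N).val : ℤ) p : ℤ) : CyclotomicField N ℚ) := by
      rw [← jacobiSym.legendreSym.to_jacobiSym]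
      simp [hχ, legendreSym]
    have h4 : χ hcop.unit * χ hcop.unit = 1 := by
      rw [h3]
      have h5 : jacobiSym ((K : ZMod N).val : ℤ) p ^ 2 = 1 := jacobiSym.sq_one (by
        rw [Int.gcd_natCast_natCast]
        exact Nat.Coprime.coprime_dvd_right h (ZMod.val_coe_unit_coprime K))
      rw [← sq]
      exact_mod_cast h5
    rw [h1, ← h2, ← h3, ← mul_assoc, h4, one_mul]

theorem natCast_val_unitsMap {n m : ℕ} (hn : n ∣ N) (hm : m ∣ n) (K : (ZMod N)ˣ) :
    (((ZMod.unitsMap hn K : (ZMod n)ˣ) : ZMod n).val : ZMod m) = ((K : ZMod N).val : ZMod m) := by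
  have : NeZero n := ⟨fun h => NeZero.ne N (by rw [h] at hn; exact zero_dvd_iff.1 hn)⟩
  have h : ((ZMod.unitsMap hn K : (ZMod n)ˣ) : ZMod n) = (((K : ZMod N).val : ℕ) : ZMod n) := by
    rw [ZMod.unitsMap_val, ZMod.natCast_val]
  rw [h, ZMod.val_natCast, ZMod.natCast_eq_natCast_iff]
  exact (Nat.mod_modEq _ _).of_dvd hm

theorem mem_oddPrimes {n p : ℕ} : p ∈ oddPrimes n ↔ p ≠ 2 ∧ p.Prime ∧ p ∣ n ∧ n ≠ 0 := by
  rw [oddPrimes, Finset.mem_erase, Nat.mem_primeFactors]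

theorem pow_dvd_of_le_factorization {n k : ℕ} (h : k ≤ n.factorization 2) : 2 ^ k ∣ n :=
  (pow_dvd_pow 2 h).trans (Nat.ordProj_dvd n 2)

/-- The root is built factor by factor. The constraints on `w₀` and `w` say exactly that `8 ∣ n` or
`4 ∣ n` when `√2` or `i` is needed. Allowing a multiple `N` of `n` makes symbols of different moduli
comparable. -/
theorem DeltaExponents.hasSqrtWith {n : ℕ} (hn : n ∣ N) (e : DeltaExponents n) :
    HasSqrtWith N e.delta fun K => e.symbol (ZMod.unitsMap hn K) := by
  unfold DeltaExponents.delta DeltaExponents.symbol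
  refine HasSqrtWith.mul (HasSqrtWith.mul ?_ ?_) (HasSqrtWith.prod _ fun p hp => ?_)
  · refine HasSqrtWith.pow_fin_two _ fun h0 => ?_
    have h8 : 8 ∣ n := pow_dvd_of_le_factorization (k := 3)
      (not_lt.1 fun h => h0 (e.w₀_eq_zero h))
    simp only [natCast_val_unitsMap hn h8]
    exact hasSqrtWith_two (h8.trans hn)
  · refine HasSqrtWith.pow_fin_two _ fun h0 => ?_
    have h4 : 4 ∣ n := pow_dvd_of_le_factorization (k := 2)
      (not_lt.1 fun h => h0 (e.w_eq_zero h))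
    simp only [natCast_val_unitsMap hn h4]
    exact hasSqrtWith_neg_one (h4.trans hn)
  · refine HasSqrtWith.pow_fin_two _ fun h0 => ?_
    obtain ⟨hp2, hp', hpn, -⟩ := mem_oddPrimes.1 hp
    convert hasSqrtWith_prime hp' hp2 (hpn.trans hn) using 2 with K
    refine jacobiSym.mod_left' ?_
    have := natCast_val_unitsMap hn hpn K
    rw [ZMod.natCast_eq_natCast_iff] at this
    exact_mod_cast this

theorem DeltaExponents.delta_ne_zero {n : ℕ} (e : DeltaExponents n) : e.delta ≠ 0 := by
  unfold DeltaExponents.delta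
  refine mul_ne_zero (mul_ne_zero (pow_ne_zero _ (by norm_num)) (pow_ne_zero _ (by norm_num)))
    (Finset.prod_ne_zero_iff.2 fun p hp => pow_ne_zero _ (mul_ne_zero (pow_ne_zero _ (by norm_num)) ?_))
  exact_mod_cast (mem_oddPrimes.1 hp).2.1.ne_zero

/-- Two roots of `a` differ by a sign, which every automorphism fixes. So the character depends on
`a` alone; this is how `Δ` determines its symbol without recovering the exponents from it. -/
theorem HasSqrtWith.eq_of_eq {a : ℤ} {ψ φ : (ZMod N)ˣ → ℤ} (ha : a ≠ 0) (h : HasSqrtWith N a ψ)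
    (h' : HasSqrtWith N a φ) (K : (ZMod N)ˣ) : ψ K = φ K := by
  obtain ⟨s, hs, hs'⟩ := h
  obtain ⟨t, ht, ht'⟩ := h'
  have hs0 : s ≠ 0 := by
    rintro rfl
    exact ha (by exact_mod_cast (by simpa using hs.symm : (a : CyclotomicField N ℚ) = 0))
  have h1 : (ψ K : CyclotomicField N ℚ) * s = φ K * s := by
    rcases sq_eq_sq_iff_eq_or_eq_neg.1 (ht.trans hs.symm) with h | h
    · rw [← hs', ← h, ht']
    · have := ht' K
      rw [h, map_neg, hs'] at this
      linear_combination -this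
  exact_mod_cast mul_right_cancel₀ hs0 h1

theorem HasSqrtWith.map_mul {a : ℤ} {ψ : (ZMod N)ˣ → ℤ} (ha : a ≠ 0) (h : HasSqrtWith N a ψ)
    (K K' : (ZMod N)ˣ) : ψ (K * K') = ψ K * ψ K' := by
  obtain ⟨s, hs, hs'⟩ := h
  have hs0 : s ≠ 0 := by
    rintro rfl
    exact ha (by exact_mod_cast (by simpa using hs.symm : (a : CyclotomicField N ℚ) = 0))
  have h1 := hs' (K * K')
  rw [cycAut_mul, hs', _root_.map_mul, map_intCast, hs', ← mul_assoc, mul_comm (ψ K' : CyclotomicField N ℚ)] at h1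
  exact_mod_cast (mul_right_cancel₀ hs0 h1).symm

theorem HasSqrtWith.eq_one_or {a : ℤ} {ψ : (ZMod N)ˣ → ℤ} (ha : a ≠ 0) (h : HasSqrtWith N a ψ)
    (K : (ZMod N)ˣ) : ψ K = 1 ∨ ψ K = -1 := by
  obtain ⟨s, hs, hs'⟩ := h
  have ha' : (a : CyclotomicField N ℚ) ≠ 0 := by exact_mod_cast ha
  have h1 := congrArg (cycAut K) hs
  rw [map_pow, hs', map_intCast, mul_pow, hs] at h1
  have h2 : (ψ K : CyclotomicField N ℚ) ^ 2 = 1 := mul_right_cancel₀ ha' (h1.trans (one_mul _).symm)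
  exact mul_self_eq_one_iff.1 (by rw [← sq]; exact_mod_cast h2)

end Galois

/-! ### The symbol as a quadratic character of the units -/

namespace DeltaExponents

variable {n : ℕ} [NeZero n]

theorem hasSqrtWith_self (e : DeltaExponents n) : HasSqrtWith n e.delta e.symbol := by
  simpa [ZMod.unitsMap_self] using e.hasSqrtWith (dvd_refl n)

theorem symbol_mul (e : DeltaExponents n) (k l : (ZMod n)ˣ) :
    e.symbol (k * l) = e.symbol k * e.symbol l :=
  e.hasSqrtWith_self.map_mul e.delta_ne_zero k l

theorem symbol_eq_one_or (e : DeltaExponents n) (k : (ZMod n)ˣ) :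
    e.symbol k = 1 ∨ e.symbol k = -1 :=
  e.hasSqrtWith_self.eq_one_or e.delta_ne_zero k

theorem symbol_one (e : DeltaExponents n) : e.symbol 1 = 1 := by
  have h := e.symbol_mul 1 1
  rcases e.symbol_eq_one_or 1 with h1 | h1 <;> simp_all

theorem symbol_eq_of_delta_eq {n N : ℕ} [NeZero N] (hn : n ∣ N) {e : DeltaExponents N}
    {e' : DeltaExponents n} (h : e'.delta = e.delta) (K : (ZMod N)ˣ) :
    e'.symbol (ZMod.unitsMap hn K) = e.symbol K :=
  (e'.hasSqrtWith hn).eq_of_eq e'.delta_ne_zero (h ▸ e.hasSqrtWith_self) K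

theorem symbol_eq_of_delta_eq_self {e e' : DeltaExponents n} (h : e'.delta = e.delta)
    (k : (ZMod n)ˣ) : e'.symbol k = e.symbol k :=
  e'.hasSqrtWith_self.eq_of_eq e'.delta_ne_zero (h ▸ e.hasSqrtWith_self) k

theorem mem_H_iff (e : DeltaExponents n) (k : (ZMod n)ˣ) : k ∈ H n e.delta ↔ e.symbol k = 1 :=
  ⟨fun ⟨_, h, h'⟩ => (symbol_eq_of_delta_eq_self h k).symm.trans h', fun h => ⟨e, rfl, h⟩⟩

/-- At `-1` each factor of the symbol is the sign of the matching factor of `delta`, so `delta` is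
the symbol at `-1` times a nonnegative number. In Galois terms, complex conjugation negates an
imaginary root. -/
theorem symbol_neg_one (e : DeltaExponents n) (h : e.delta < 0) : e.symbol (-1) = -1 := by
  have hval : ∀ m : ℕ, m ∣ n → ((((-1 : (ZMod n)ˣ) : ZMod n).val : ℕ) : ZMod m) = -1 := by
    intro m hm
    rw [ZMod.natCast_val, Units.val_neg, Units.val_one, ← ZMod.castHom_apply (h := hm), map_neg,
      map_one]
  have key : e.delta = e.symbol (-1) *
      (2 ^ (e.w₀ : ℕ) * ∏ p ∈ oddPrimes n, (p : ℤ) ^ (e.wp p : ℕ)) := by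
    have h1 : ZMod.χ₈ ((((-1 : (ZMod n)ˣ) : ZMod n).val : ℕ) : ZMod 8) ^ (e.w₀ : ℕ) = 1 := by
      by_cases h0 : e.w₀ = 0
      · simp [h0]
      · rw [hval 8 (pow_dvd_of_le_factorization (k := 3) (not_lt.1 fun h => h0 (e.w₀_eq_zero h))),
          show ZMod.χ₈ (-1) = 1 from by decide, one_pow]
    have h2 : ZMod.χ₄ ((((-1 : (ZMod n)ˣ) : ZMod n).val : ℕ) : ZMod 4) ^ (e.w : ℕ) =
        (-1) ^ (e.w : ℕ) := by
      by_cases h0 : e.w = 0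
      · simp [h0]
      · rw [hval 4 (pow_dvd_of_le_factorization (k := 2) (not_lt.1 fun h => h0 (e.w_eq_zero h))),
          show ZMod.χ₄ (-1) = -1 from by decide]
    have h3 : ∀ p ∈ oddPrimes n,
        jacobiSym ((((-1 : (ZMod n)ˣ) : ZMod n).val : ℕ) : ℤ) p = (-1) ^ ((p - 1) / 2) := by
      intro p hp
      obtain ⟨hp2, hp', hpn, -⟩ := mem_oddPrimes.1 hp
      have hodd := hp'.eq_two_or_odd.resolve_left hp2
      have h4 : jacobiSym ((((-1 : (ZMod n)ˣ) : ZMod n).val : ℕ) : ℤ) p = jacobiSym (-1) p := by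
        refine jacobiSym.mod_left' ((ZMod.intCast_eq_intCast_iff _ _ _).1 ?_)
        have := hval p hpn
        push_cast
        exact this
      rw [h4, jacobiSym.at_neg_one (Nat.odd_iff.2 hodd), ZMod.χ₄_eq_neg_one_pow hodd]
      congr 1
      omega
    have h5 : ∏ p ∈ oddPrimes n,
        jacobiSym ((((-1 : (ZMod n)ˣ) : ZMod n).val : ℕ) : ℤ) p ^ (e.wp p : ℕ) =
        ∏ p ∈ oddPrimes n, ((-1) ^ ((p - 1) / 2)) ^ (e.wp p : ℕ) :=
      Finset.prod_congr rfl fun p hp => by rw [h3 p hp]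
    rw [delta, symbol, h1, h2, h5]
    simp only [mul_pow, Finset.prod_mul_distrib]
    ring
  rcases e.symbol_eq_one_or (-1) with h1 | h1
  · rw [key, h1, one_mul] at h
    exact absurd h (not_lt.2 (mul_nonneg (by positivity)
      (Finset.prod_nonneg fun p _ => by positivity)))
  · exact h1

end DeltaExponents

/-! ### Discriminants of a modulus and of its divisors -/

section Descent

variable {n N : ℕ} [NeZero N]

/-- A unit modulo `N` that is `c` at the prime `q`, `1` away from `q`, and `1` modulo the divisor
`n` of `N`. -/
theorem exists_unit_unitsMap_eq_one {q c : ℕ} (hq : q.Prime) (hn : n ∣ N) (hcq : c.Coprime q)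
    (hc : c ≡ 1 [MOD q ^ n.factorization q]) :
    ∃ K : (ZMod N)ˣ, ZMod.unitsMap hn K = 1 ∧
      (∀ m, m ∣ q ^ N.factorization q → ((K : ZMod N).val : ZMod m) = c) ∧
      ∀ m, m ∣ N → m.Coprime q → ((K : ZMod N).val : ZMod m) = 1 := by
  have hN0 : N ≠ 0 := NeZero.ne N
  have hn0 : n ≠ 0 := fun h => hN0 (by rw [h] at hn; exact zero_dvd_iff.1 hn)
  have hNN : q ^ N.factorization q * (N / q ^ N.factorization q) = N :=
    Nat.ordProj_mul_ordCompl_eq_self N q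
  have hcop : Nat.Coprime (q ^ N.factorization q) (N / q ^ N.factorization q) :=
    (Nat.coprime_ordCompl hq hN0).pow_left _
  obtain ⟨k, hk1, hk2⟩ := Nat.chineseRemainder hcop c 1
  have hkN : k.Coprime N := by
    rw [← hNN]
    refine Nat.Coprime.mul_right ?_ ?_
    · rw [Nat.Coprime, hk1.gcd_eq]
      exact hcq.pow_right _
    · rw [Nat.Coprime, hk2.gcd_eq, Nat.gcd_one_left]
  have hval : ∀ m, m ∣ N →
      ((((ZMod.unitOfCoprime k hkN : (ZMod N)ˣ) : ZMod N).val : ℕ) : ZMod m) = k := by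
    intro m hm
    rw [ZMod.coe_unitOfCoprime, ZMod.val_natCast, ZMod.natCast_eq_natCast_iff]
    exact (Nat.mod_modEq _ _).of_dvd hm
  have hdvd : ∀ m, m ∣ N → m.Coprime q → m ∣ N / q ^ N.factorization q := by
    intro m hm hmq
    refine (hmq.pow_right (N.factorization q)).dvd_of_dvd_mul_left ?_
    rwa [hNN]
  have h1 : ∀ m, m ∣ N → m.Coprime q → k ≡ 1 [MOD m] := fun m hm hmq =>
    hk2.of_dvd (hdvd m hm hmq)
  refine ⟨ZMod.unitOfCoprime k hkN, ?_, fun m hm => ?_, fun m hm hmq => ?_⟩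
  · refine Units.ext ?_
    have hnn : q ^ n.factorization q * (n / q ^ n.factorization q) = n :=
      Nat.ordProj_mul_ordCompl_eq_self n q
    have hle : n.factorization q ≤ N.factorization q :=
      (Nat.factorization_le_iff_dvd hn0 hN0).2 hn q
    have hkn : k ≡ 1 [MOD n] := by
      rw [← hnn]
      refine (Nat.modEq_and_modEq_iff_modEq_mul ((Nat.coprime_ordCompl hq hn0).pow_left _)).1 ⟨?_, ?_⟩
      · exact (hk1.of_dvd (pow_dvd_pow q hle)).trans hc
      · exact h1 _ ((Nat.ordCompl_dvd n q).trans hn) (Nat.coprime_ordCompl hq hn0).symm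
    rw [ZMod.unitsMap_val, ZMod.coe_unitOfCoprime, ← ZMod.natCast_val, ZMod.val_natCast,
      Units.val_one, ← Nat.cast_one, ZMod.natCast_eq_natCast_iff]
    exact ((Nat.mod_modEq _ _).of_dvd hn).trans hkn
  · rw [hval m (hm.trans (Nat.ordProj_dvd N q)), ZMod.natCast_eq_natCast_iff]
    exact hk1.of_dvd hm
  · rw [hval m hm, ← Nat.cast_one, ZMod.natCast_eq_natCast_iff]
    exact h1 m hm hmq

theorem jacobiSym_eq_of_natCast_eq {v p : ℕ} {c : ℕ} (h : (v : ZMod p) = c) :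
    jacobiSym v p = jacobiSym c p := by
  rw [ZMod.natCast_eq_natCast_iff] at h
  exact jacobiSym.mod_left' (by exact_mod_cast h)

/-- A discriminant attached to `N` is one attached to the divisor `n` of `N` or its symbol is
nontrivial on the units that are `1` modulo `n`. -/
theorem DeltaExponents.isDelta_or_exists_symbol_eq_neg_one (hn : n ∣ N) (e : DeltaExponents N) :
    IsDelta n e.delta ∨ ∃ K : (ZMod N)ˣ, ZMod.unitsMap hn K = 1 ∧ e.symbol K = -1 := by
  have hN0 : N ≠ 0 := NeZero.ne N
  have hn0 : n ≠ 0 := fun h => hN0 (by rw [h] at hn; exact zero_dvd_iff.1 hn)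
  have h3 : e.w₀ ≠ 0 → 3 ≤ N.factorization 2 := fun h0 => not_lt.1 fun h => h0 (e.w₀_eq_zero h)
  have h2 : e.w ≠ 0 → 2 ≤ N.factorization 2 := fun h0 => not_lt.1 fun h => h0 (e.w_eq_zero h)
  have hone : ∀ i : Fin 2, i ≠ 0 → (i : ℕ) = 1 := by decide
  -- A prime of `Δ` outside `n` puts no constraint on the unit at `p`: take a nonresidue there and 1
  -- elsewhere.
  by_cases c1 : ∃ p ∈ oddPrimes N, e.wp p ≠ 0 ∧ ¬ p ∣ n
  · right
    obtain ⟨p, hp, hw, hpn⟩ := c1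
    obtain ⟨hp2, hp', hpN, -⟩ := mem_oddPrimes.1 hp
    have : Fact p.Prime := ⟨hp'⟩
    obtain ⟨x, hx⟩ := FiniteField.exists_nonsquare (F := ZMod p) (by rwa [ZMod.ringChar_zmod_n])
    have hx0 : x ≠ 0 := fun h => hx (h ▸ IsSquare.zero)
    have hxc : x.val.Coprime p := by
      refine (ZMod.isUnit_iff_coprime _ _).1 ?_
      rw [ZMod.natCast_zmod_val]
      exact hx0.isUnit
    obtain ⟨K, hK1, hKp, hK⟩ := exists_unit_unitsMap_eq_one hp' hn hxc
      (by rw [Nat.factorization_eq_zero_of_not_dvd hpn, pow_zero]; exact Nat.modEq_one)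
    refine ⟨K, hK1, ?_⟩
    have hcop2 : ∀ k, Nat.Coprime (2 ^ k) p := fun k =>
      ((Nat.coprime_primes Nat.prime_two hp').2 hp2.symm).pow_left k
    have e1 : ZMod.χ₈ ((K : ZMod N).val : ZMod 8) ^ (e.w₀ : ℕ) = 1 := by
      by_cases h0 : e.w₀ = 0
      · simp [h0]
      · rw [hK 8 (pow_dvd_of_le_factorization (k := 3) (h3 h0)) (hcop2 3), map_one, one_pow]
    have e2 : ZMod.χ₄ ((K : ZMod N).val : ZMod 4) ^ (e.w : ℕ) = 1 := by
      by_cases h0 : e.w = 0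
      · simp [h0]
      · rw [hK 4 (pow_dvd_of_le_factorization (k := 2) (h2 h0)) (hcop2 2), map_one, one_pow]
    rw [DeltaExponents.symbol, e1, e2, one_mul, one_mul, Finset.prod_eq_single_of_mem p hp]
    · rw [hone _ hw, pow_one, jacobiSym_eq_of_natCast_eq (hKp p (dvd_pow_self p
        (Nat.one_le_iff_ne_zero.1 ((hp'.dvd_iff_one_le_factorization hN0).1 hpN)))),
        ← jacobiSym.legendreSym.to_jacobiSym, legendreSym.eq_neg_one_iff]
      simpa using hx
    · intro q hq hqp
      obtain ⟨hq2, hq', hqN, -⟩ := mem_oddPrimes.1 hq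
      rw [jacobiSym_eq_of_natCast_eq (c := 1) (by
        rw [hK q hqN ((Nat.coprime_primes hq' hp').2 hqp), Nat.cast_one]), Nat.cast_one,
        jacobiSym.one_left, one_pow]
  have hprod : ∀ K : (ZMod N)ˣ, (∀ m, m ∣ N → m.Coprime 2 → ((K : ZMod N).val : ZMod m) = 1) →
      ∏ p ∈ oddPrimes N, jacobiSym ((K : ZMod N).val : ℤ) p ^ (e.wp p : ℕ) = 1 := by
    intro K hK
    refine Finset.prod_eq_one fun q hq => ?_
    obtain ⟨hq2, hq', hqN, -⟩ := mem_oddPrimes.1 hq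
    rw [jacobiSym_eq_of_natCast_eq (c := 1) (by
      rw [hK q hqN ((Nat.coprime_primes hq' Nat.prime_two).2 hq2), Nat.cast_one]), Nat.cast_one,
      jacobiSym.one_left, one_pow]
  by_cases c2 : e.w₀ ≠ 0 ∧ n.factorization 2 < 3
  · right
    obtain ⟨h0, hlt⟩ := c2
    -- 5 is 1 modulo 4, hence modulo the 2-part of `n`, while `χ₈(5) = -1`; since `χ₄(5) = 1`, the
    -- value of `w` is irrelevant.
    obtain ⟨K, hK1, hK2, hK⟩ := exists_unit_unitsMap_eq_one (q := 2) (c := 5) Nat.prime_two hn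
      (by norm_num) (Nat.ModEq.of_dvd (pow_dvd_pow 2 (Nat.lt_succ_iff.1 hlt)) (by decide))
    refine ⟨K, hK1, ?_⟩
    rw [DeltaExponents.symbol, hprod K hK, hK2 8 (pow_dvd_pow 2 (h3 h0)),
      hK2 4 (pow_dvd_pow 2 ((show 2 ≤ 3 by norm_num).trans (h3 h0))), hone _ h0,
      show ZMod.χ₈ ((5 : ℕ) : ZMod 8) = -1 from by decide,
      show ZMod.χ₄ ((5 : ℕ) : ZMod 4) = 1 from by decide]
    simp
  by_cases c3 : e.w ≠ 0 ∧ n.factorization 2 < 2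
  · right
    obtain ⟨h0, hlt⟩ := c3
    have hw0 : e.w₀ = 0 := by
      by_contra h
      exact c2 ⟨h, by omega⟩
    -- Here the 2-part of `n` is at most 2, so 3 is allowed; `w₀ = 0` keeps `χ₈(3) = -1` from
    -- cancelling `χ₄(3) = -1`.
    obtain ⟨K, hK1, hK2, hK⟩ := exists_unit_unitsMap_eq_one (q := 2) (c := 3) Nat.prime_two hn
      (by norm_num) (Nat.ModEq.of_dvd (pow_dvd_pow 2 (Nat.lt_succ_iff.1 hlt)) (by decide))
    refine ⟨K, hK1, ?_⟩
    rw [DeltaExponents.symbol, hprod K hK, hK2 4 (pow_dvd_pow 2 (h2 h0)), hone _ h0, hw0,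
      show ZMod.χ₄ ((3 : ℕ) : ZMod 4) = -1 from by decide]
    simp
  · left
    push Not at c1 c2 c3
    refine ⟨⟨e.w₀, e.w, e.wp, fun h => ?_, fun h => ?_⟩, ?_⟩
    · by_contra h0
      exact absurd (c2 h0) (not_le.2 h)
    · by_contra h0
      exact absurd (c3 h0) (not_le.2 h)
    · unfold DeltaExponents.delta
      congr 1
      refine Finset.prod_subset (fun p hp => ?_) fun p hp hpn => ?_
      · obtain ⟨hp2, hp', hpn, -⟩ := mem_oddPrimes.1 hp
        exact mem_oddPrimes.2 ⟨hp2, hp', hpn.trans hn, hN0⟩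
      · by_cases hw : e.wp p = 0
        · simp [hw]
        · exact absurd (mem_oddPrimes.2 ⟨(mem_oddPrimes.1 hp).1, (mem_oddPrimes.1 hp).2.1,
            c1 p hp hw, hn0⟩) hpn

/-- The discriminant `1`. -/
theorem isDelta_one (n : ℕ) : IsDelta n 1 :=
  ⟨⟨0, 0, fun _ => 0, fun _ => rfl, fun _ => rfl⟩, by simp [DeltaExponents.delta]⟩

/-- This is the dichotomy for the divisor 1 of `N`, to which only the discriminant 1 is attached. -/
theorem DeltaExponents.exists_symbol_eq_neg_one (e : DeltaExponents N) (h : e.delta ≠ 1) :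
    ∃ k : (ZMod N)ˣ, e.symbol k = -1 := by
  rcases e.isDelta_or_exists_symbol_eq_neg_one (one_dvd N) with ⟨e', h'⟩ | ⟨K, -, hK⟩
  · refine absurd (h'.symm.trans ?_) h
    have h0 : e'.w₀ = 0 := e'.w₀_eq_zero (by simp)
    have h1 : e'.w = 0 := e'.w_eq_zero (by simp)
    simp [DeltaExponents.delta, h0, h1, oddPrimes]
  · exact ⟨K, hK⟩

theorem DeltaExponents.symbol_eq_one_of_delta_eq_one (e : DeltaExponents N) (h : e.delta = 1)
    (k : (ZMod N)ˣ) : e.symbol k = 1 := by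
  obtain ⟨K, hK⟩ : ∃ e' : DeltaExponents N, e'.delta = e.delta ∧ e'.symbol k = 1 :=
    ⟨⟨0, 0, fun _ => 0, fun _ => rfl, fun _ => rfl⟩, by rw [h]; simp [DeltaExponents.delta],
      by simp [DeltaExponents.symbol]⟩
  rw [← symbol_eq_of_delta_eq_self hK.1, hK.2]

omit [NeZero N] in
/-- Every squarefree divisor of a multiple `N` of `8` is, up to either sign, a discriminant attached
to `N`. -/
theorem isDelta_of_squarefree (h8 : 8 ∣ N) (hN0 : N ≠ 0) {d : ℕ} (hd : Squarefree d) (hdN : d ∣ N) :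
    IsDelta N d ∧ IsDelta N (-d) := by
  classical
  have hf : 3 ≤ N.factorization 2 :=
    (Nat.prime_two.pow_dvd_iff_le_factorization hN0).1 (by simpa using h8)
  have hd0 : d ≠ 0 := hd.ne_zero
  -- The exponents are read off from the primes of `d`. The sign that results for `w = 0` depends on
  -- the primes modulo 4, but changing `w` flips it, so both signs occur.
  let E : Fin 2 → DeltaExponents N := fun w =>
    ⟨if 2 ∣ d then 1 else 0, w, fun p => if p ∣ d then 1 else 0,
      fun h => absurd h (by omega), fun h => absurd h (by omega)⟩
  have hE1 : (E 1).delta = -(E 0).delta := by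
    simp [E, DeltaExponents.delta]
  have hE0 : (E 0).delta.natAbs = d := by
    have h1 : ∀ p ∈ oddPrimes N, (((-1) ^ ((p - 1) / 2) * (p : ℤ)) ^
        ((if p ∣ d then 1 else 0 : Fin 2) : ℕ)).natAbs = if p ∣ d then p else 1 := by
      intro p _
      split_ifs <;> simp [Int.natAbs_mul, Int.natAbs_pow]
    have h2 : (2 ^ ((if 2 ∣ d then 1 else 0 : Fin 2) : ℕ) : ℤ).natAbs = if 2 ∣ d then 2 else 1 := by
      split_ifs <;> simp
    have h3 : d.primeFactors = N.primeFactors.filter (· ∣ d) := by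
      ext p
      simp only [Nat.mem_primeFactors, Finset.mem_filter]
      exact ⟨fun h => ⟨⟨h.1, h.2.1.trans hdN, hN0⟩, h.2.1⟩, fun h => ⟨h.1.1, h.2, hd0⟩⟩
    have h4 : (2 : ℕ) ∈ N.primeFactors :=
      Nat.mem_primeFactors.2 ⟨Nat.prime_two, (by norm_num : 2 ∣ 8).trans h8, hN0⟩
    simp only [DeltaExponents.delta, E, Int.natAbs_mul, h2]
    rw [← Int.natAbsHom_apply (∏ p ∈ _, _), map_prod]
    simp only [Int.natAbsHom_apply]
    rw [Finset.prod_congr rfl h1]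
    conv_rhs => rw [← Nat.prod_primeFactors_of_squarefree hd, h3, Finset.prod_filter,
      ← Finset.mul_prod_erase _ _ h4]
    simp [oddPrimes]
  rcases Int.natAbs_eq (E 0).delta with h | h <;> rw [hE0] at h
  · exact ⟨⟨E 0, h⟩, ⟨E 1, by rw [hE1, h]⟩⟩
  · exact ⟨⟨E 1, by rw [hE1, h, neg_neg]⟩, ⟨E 0, h⟩⟩

end Descent

/-! ### Powers by units and group matrices -/

section UnitPow

variable {G : Type*} [Group G] {N : ℕ}

theorem pow_val_mul {g : G} (hg : g ^ N = 1) (k l : (ZMod N)ˣ) :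
    g ^ ((k * l : (ZMod N)ˣ) : ZMod N).val = (g ^ (k : ZMod N).val) ^ (l : ZMod N).val := by
  rw [Units.val_mul, ZMod.val_mul, ← pow_mul]
  conv_rhs => rw [← Nat.div_add_mod ((k : ZMod N).val * (l : ZMod N).val) N, pow_add, pow_mul, hg,
    one_pow, one_mul]

theorem pow_val_one {g : G} (hg : g ^ N = 1) : g ^ ((1 : (ZMod N)ˣ) : ZMod N).val = g := by
  rw [Units.val_one, ZMod.val_one_eq_one_mod]
  conv_rhs => rw [← pow_one g, ← Nat.div_add_mod 1 N, pow_add, pow_mul, hg, one_pow, one_mul]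

theorem pow_val_inv {g : G} (hg : g ^ N = 1) (k : (ZMod N)ˣ) :
    (g ^ (k : ZMod N).val) ^ ((k⁻¹ : (ZMod N)ˣ) : ZMod N).val = g := by
  rw [← pow_val_mul hg, mul_inv_cancel, pow_val_one hg]

theorem pow_val_inv' {g : G} (hg : g ^ N = 1) (k : (ZMod N)ˣ) :
    (g ^ ((k⁻¹ : (ZMod N)ˣ) : ZMod N).val) ^ (k : ZMod N).val = g := by
  rw [← pow_val_mul hg, inv_mul_cancel, pow_val_one hg]

theorem pow_val_neg_one [NeZero N] {g : G} (hg : g ^ N = 1) :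
    g ^ ((-1 : (ZMod N)ˣ) : ZMod N).val = g⁻¹ := by
  rw [eq_inv_iff_mul_eq_one, ← pow_succ]
  have : N ∣ ((-1 : (ZMod N)ˣ) : ZMod N).val + 1 := by
    rw [← ZMod.natCast_eq_zero_iff]
    push_cast
    rw [ZMod.natCast_zmod_val]
    simp
  obtain ⟨c, hc⟩ := this
  rw [hc, pow_mul, hg, one_pow]

/-- The permutation `g ↦ g ^ k` for a unit `k` modulo a multiple of the exponent. -/
def unitPowEquiv (hN : ∀ g : G, g ^ N = 1) (k : (ZMod N)ˣ) : G ≃ G where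
  toFun g := g ^ (k : ZMod N).val
  invFun g := g ^ ((k⁻¹ : (ZMod N)ˣ) : ZMod N).val
  left_inv g := pow_val_inv (hN g) k
  right_inv g := pow_val_inv' (hN g) k

end UnitPow

section GroupMatrix

variable {G : Type*} [Group G]

/-- The matrix `f (b a⁻¹)` of an integer valued function on a group. -/
def groupMatrix (f : G → ℤ) : Matrix G G ℂ := Matrix.of fun a b => (f (b * a⁻¹) : ℂ)

/-- Invariance under conjugation. -/
def IsClassFun (f : G → ℤ) : Prop := ∀ g x, f (x * g * x⁻¹) = f g

theorem groupMatrix_conjTranspose (f : G → ℤ) :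
    (groupMatrix f).conjTranspose = groupMatrix fun g => f g⁻¹ := by
  ext a b
  simp [groupMatrix, Matrix.conjTranspose_apply]

theorem groupMatrix_transpose (f : G → ℤ) :
    (groupMatrix f).transpose = groupMatrix fun g => f g⁻¹ := by
  ext a b
  simp [groupMatrix, Matrix.transpose_apply]

variable [Fintype G] [DecidableEq G]

/-- The permutation matrix of multiplication by `g`. -/
abbrev regMatrix (g : G) : Matrix G G ℂ := groupMatrix (Pi.single g 1)

theorem groupMatrix_eq_sum (f : G → ℤ) : groupMatrix f = ∑ g, (f g : ℂ) • regMatrix g := by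
  ext a b
  simp [groupMatrix, Matrix.sum_apply, Pi.single_apply]

/-- The order is reversed because row `a` of `regMatrix g` has its 1 in column `g * a`. -/
theorem regMatrix_mul (g h : G) : regMatrix g * regMatrix h = regMatrix (h * g) := by
  ext a c
  simp only [regMatrix, groupMatrix, Matrix.mul_apply, Matrix.of_apply, Pi.single_apply]
  rw [Finset.sum_eq_single (g * a)]
  · simp [mul_assoc, ← eq_mul_inv_iff_mul_eq]
  · intro b _ hb
    rw [if_neg fun h => hb (by rw [← h]; group)]
    simp
  · simp

omit [Fintype G] in
theorem regMatrix_one : regMatrix (1 : G) = 1 := by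
  ext a b
  simp [groupMatrix, Matrix.one_apply, Pi.single_apply, mul_inv_eq_one, eq_comm]

theorem regMatrix_pow (g : G) (m : ℕ) : regMatrix g ^ m = regMatrix (g ^ m) := by
  induction m with
  | zero => rw [pow_zero, pow_zero, regMatrix_one]
  | succ m ih => rw [pow_succ, ih, regMatrix_mul, pow_succ']

theorem IsClassFun.commute_regMatrix {f : G → ℤ} (hf : IsClassFun f) (h : G) :
    Commute (groupMatrix f) (regMatrix h) := by
  ext a c
  simp only [regMatrix, groupMatrix, Matrix.mul_apply, Matrix.of_apply, Pi.single_apply]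
  rw [Finset.sum_eq_single (h⁻¹ * c), Finset.sum_eq_single (h * a)]
  · have := hf (h⁻¹ * c * a⁻¹) h
    rw [← this]
    simp [mul_assoc]
  · intro b _ hb
    rw [if_neg fun h => hb (by rw [← h]; group)]
    simp
  · simp
  · intro b _ hb
    rw [if_neg fun h => hb (by rw [← h]; group)]
    simp
  · simp

theorem IsClassFun.commute {f f' : G → ℤ} (hf : IsClassFun f) :
    Commute (groupMatrix f) (groupMatrix f') := by
  rw [groupMatrix_eq_sum f']
  exact Commute.sum_right _ _ _ fun g _ => (hf.commute_regMatrix g).smul_right _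

omit [DecidableEq G] in
theorem trace_groupMatrix (f : G → ℤ) : (groupMatrix f).trace = Fintype.card G * f 1 := by
  simp [Matrix.trace, groupMatrix]

theorem trace_groupMatrix_mul (f : G → ℤ) (P : Matrix G G ℂ) :
    (groupMatrix f * P).trace = ∑ g, (f g : ℂ) * (regMatrix g * P).trace := by
  rw [groupMatrix_eq_sum f, Finset.sum_mul, Matrix.trace_sum]
  exact Finset.sum_congr rfl fun g _ => by rw [smul_mul_assoc, Matrix.trace_smul, smul_eq_mul]

omit [DecidableEq G] in
theorem trace_groupMatrix_mul_conjTranspose (f f' : G → ℤ) :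
    (groupMatrix f * (groupMatrix f').conjTranspose).trace =
      Fintype.card G * ((∑ g, f g * f' g : ℤ) : ℂ) := by
  simp only [Matrix.trace, Matrix.diag_apply, Matrix.mul_apply, groupMatrix,
    Matrix.conjTranspose_apply, Matrix.of_apply]
  have : ∀ a : G, ∑ b, (f (b * a⁻¹) : ℂ) * star (f' (b * a⁻¹) : ℂ) = ((∑ g, f g * f' g : ℤ) : ℂ) := by
    intro a
    refine (Fintype.sum_equiv (Equiv.mulRight a⁻¹) _ (fun g => (f g : ℂ) * star (f' g : ℂ))
      fun b => rfl).trans ?_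
    simp
  rw [Finset.sum_congr rfl fun a _ => this a]
  simp

/-- The Galois action on the traces of group elements compressed by a central idempotent. -/
theorem exists_trace_regMatrix_mul {N : ℕ} [NeZero N] (hN : ∀ g : G, g ^ N = 1)
    (ι : CyclotomicField N ℚ →+* ℂ) {P : Matrix G G ℂ} (hP : IsIdempotentElem P)
    (hc : ∀ g, Commute P (regMatrix g)) :
    ∃ x : G → CyclotomicField N ℚ, (∀ g, ι (x g) = (regMatrix g * P).trace) ∧
      ∀ (K : (ZMod N)ˣ) (g : G), cycAut K (x g) = x (g ^ (K : ZMod N).val) := by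
  have hζ := IsCyclotomicExtension.zeta_spec N ℚ (CyclotomicField N ℚ)
  set ζ := IsCyclotomicExtension.zeta N ℚ (CyclotomicField N ℚ)
  -- The same multiplicities serve all powers of `g`, so passing from `g` to `g ^ K` is the same as
  -- passing from `ζ` to `ζ ^ K`.
  have hr : ∀ g : G, ∃ r : ℕ → ℕ, ∀ m : ℕ, (regMatrix (g ^ m) * P).trace =
      ∑ j ∈ Finset.range N, (r j : ℂ) * ι ζ ^ (j * m) := by
    intro g
    obtain ⟨r, hr⟩ := exists_trace_pow_mul_eq_sum (NeZero.pos N) (hζ.map_of_injective ι.injective)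
      hP (by rw [regMatrix_pow, hN, regMatrix_one]) (hc g)
    exact ⟨r, fun m => by rw [← hr m, regMatrix_pow]⟩
  choose r hr using hr
  have hx : ∀ g, ι (∑ j ∈ Finset.range N, (r g j : CyclotomicField N ℚ) * ζ ^ j) =
      (regMatrix g * P).trace := by
    intro g
    have := hr g 1
    rw [pow_one] at this
    rw [this]
    simp
  refine ⟨fun g => ∑ j ∈ Finset.range N, (r g j : CyclotomicField N ℚ) * ζ ^ j, hx, fun K g => ?_⟩
  apply ι.injective
  rw [hx, hr]
  simp only [map_sum, map_mul, map_pow, map_natCast, cycAut_apply K hζ.pow_eq_one]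
  exact Finset.sum_congr rfl fun j _ => by rw [← pow_mul, mul_comm j]

end GroupMatrix

/-! ### Rationality of eigenvalues and the Galois action -/

section Eigenvalues

open Polynomial

variable {G : Type*} [Group G] [Fintype G] [DecidableEq G] {N : ℕ} [NeZero N]

section

variable {V : Type*} [Fintype V] [DecidableEq V] {A : Matrix V V ℂ} (hA : A.IsHermitian)

/-- The eigenvalues of a Hermitian matrix, as complex numbers. -/
noncomputable def eigs : Finset ℂ :=
  Finset.univ.image fun i => (hA.eigenvalues i : ℂ)

theorem mem_eigs (i : V) : (hA.eigenvalues i : ℂ) ∈ eigs hA :=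
  Finset.mem_image_of_mem _ (Finset.mem_univ i)

theorem aeval_nodal_eigs : aeval A (Lagrange.nodal (eigs hA) id) = 0 :=
  (aeval_eq_zero_iff_of_isHermitian hA _).2 fun i =>
    Lagrange.eval_nodal_at_node (v := id) (mem_eigs hA i)

theorem specProj_eigenvalue_ne_zero (i : V) :
    specProj (eigs hA) A (hA.eigenvalues i : ℂ) ≠ 0 := by
  intro h
  have := (aeval_eq_zero_iff_of_isHermitian hA _).1 h i
  rw [show eval (hA.eigenvalues i : ℂ) (Lagrange.basis (eigs hA) id (hA.eigenvalues i : ℂ)) = 1 from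
    Lagrange.eval_basis_self (v := id) Function.injective_id.injOn (mem_eigs hA i)] at this
  exact one_ne_zero this

end

variable (hN : ∀ g : G, g ^ N = 1) (ι : CyclotomicField N ℚ →+* ℂ) {s : CyclotomicField N ℚ}
  {ψ : (ZMod N)ˣ → ℤ} {f : G → ℤ} {c : ℂ}

include hN

/-- An eigenvalue times its multiplicity becomes `c` times a cyclotomic number on which Galois acts
by permuting group elements. -/
theorem exists_trace_specProj (hf : IsClassFun f) (hH : (c • groupMatrix f).IsHermitian) {a : ℂ}
    (ha : a ∈ eigs hH) :
    ∃ x : G → CyclotomicField N ℚ,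
      (∀ g, ι (x g) = (regMatrix g * specProj (eigs hH) (c • groupMatrix f) a).trace) ∧
      (∀ (K : (ZMod N)ˣ) (g : G), cycAut K (x g) = x (g ^ (K : ZMod N).val)) ∧
      (groupMatrix f * specProj (eigs hH) (c • groupMatrix f) a).trace =
        ι (∑ g, (f g : CyclotomicField N ℚ) * x g) ∧
      a * (specProj (eigs hH) (c • groupMatrix f) a).trace =
        c * ι (∑ g, (f g : CyclotomicField N ℚ) * x g) := by
  have hid := isIdempotentElem_specProj (aeval_nodal_eigs hH) ha
  obtain ⟨x, hx, hx'⟩ := exists_trace_regMatrix_mul hN ι hid fun g =>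
    (commute_specProj ((hf.commute_regMatrix g).symm.smul_right c) a).symm
  have h2 : (groupMatrix f * specProj (eigs hH) (c • groupMatrix f) a).trace =
      ι (∑ g, (f g : CyclotomicField N ℚ) * x g) := by
    rw [trace_groupMatrix_mul, map_sum]
    exact Finset.sum_congr rfl fun g _ => by rw [map_mul, hx, map_intCast]
  refine ⟨x, hx, hx', h2, ?_⟩
  have h1 := congrArg Matrix.trace (mul_specProj (aeval_nodal_eigs hH) ha)
  rw [Matrix.trace_smul, smul_eq_mul] at h1
  rw [← h1, smul_mul_assoc, Matrix.trace_smul, smul_eq_mul, h2]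

/-- Reindexing by `g ↦ g ^ K` shows that `∑ f(g) x(g)` is multiplied by `ψ K`, just as `s` is. Their
quotient is Galois invariant, hence rational. -/
theorem eigenvalues_of_forall_apply_pow (hs : s ≠ 0)
    (hsψ : ∀ K : (ZMod N)ˣ, cycAut K s = ψ K * s) (hψ : ∀ K, ψ K = 1 ∨ ψ K = -1)
    (hf : IsClassFun f) (hH : (c • groupMatrix f).IsHermitian)
    (h : ∀ (K : (ZMod N)ˣ) (g : G), f (g ^ (K : ZMod N).val) = ψ K * f g) (i : G) :
    ∃ q : ℚ, (hH.eigenvalues i : ℂ) = c * q * ι s := by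
  obtain ⟨x, hx, hx', -, hxs⟩ := exists_trace_specProj hN ι hf hH (mem_eigs hH i)
  set P := specProj (eigs hH) (c • groupMatrix f) (hH.eigenvalues i : ℂ) with hPdef
  have hid : IsIdempotentElem P := isIdempotentElem_specProj (aeval_nodal_eigs hH) (mem_eigs hH i)
  have hP0 : P.trace ≠ 0 := fun h0 =>
    specProj_eigenvalue_ne_zero hH i (eq_zero_of_trace_eq_zero hid h0)
  obtain ⟨D, hD⟩ := exists_natCast_eq_trace hid
  have hy : ∀ K : (ZMod N)ˣ, cycAut K (∑ g, (f g : CyclotomicField N ℚ) * x g) =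
      ψ K * ∑ g, (f g : CyclotomicField N ℚ) * x g := by
    intro K
    have h2 : ∀ g, (f g : CyclotomicField N ℚ) = ψ K * f (g ^ (K : ZMod N).val) := by
      intro g
      rw [h]
      rcases hψ K with h | h <;> simp [h]
    rw [map_sum, Finset.mul_sum]
    refine Fintype.sum_equiv (unitPowEquiv hN K) _ _ fun g => ?_
    rw [map_mul, map_intCast, hx', h2, mul_assoc]
    rfl
  obtain ⟨q, hq⟩ := exists_rat_of_forall_cycAut_eq
    (x := (∑ g, (f g : CyclotomicField N ℚ) * x g) / s) fun K => by
      rw [map_div₀, hy, hsψ]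
      refine mul_div_mul_left _ _ ?_
      rcases hψ K with h | h <;> simp [h]
  rw [div_eq_iff hs] at hq
  refine ⟨q / D, ?_⟩
  rw [hq, map_mul, eq_ratCast, map_ratCast, hD] at hxs
  rw [hD] at hP0
  push_cast
  field_simp
  linear_combination hxs

/-- The hypothesis gives `tr(F'P) = ψ(K) tr(FP)` for every spectral projection `P`, where `F` and
`F'` are the matrices of `f` and `f'`. Summing against the eigenvalues yields `⟨f', f⟩ = ψ(K)⟨f,
f⟩`. As `f'` is a rearrangement of `f`, this is the equality case of Cauchy–Schwarz, so `f' = ψ(K)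
f`. -/
theorem apply_pow_of_eigenvalues (hc : c ≠ 0)
    (hsψ : ∀ K : (ZMod N)ˣ, cycAut K s = ψ K * s) (hψ : ∀ K, ψ K = 1 ∨ ψ K = -1)
    (hf : IsClassFun f) (hH : (c • groupMatrix f).IsHermitian)
    (h : ∀ i, ∃ q : ℚ, (hH.eigenvalues i : ℂ) = c * q * ι s) (K : (ZMod N)ˣ) (g : G) :
    f (g ^ (K : ZMod N).val) = ψ K * f g := by
  -- The inverse of `K` is used so that the matrix of `f'` is the sum of `f g` times the matrix of
  -- `g ^ K`.
  set f' : G → ℤ := fun g => f (g ^ ((K⁻¹ : (ZMod N)ˣ) : ZMod N).val) with hf'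
  have hF : groupMatrix f' = ∑ g, (f g : ℂ) • regMatrix (g ^ (K : ZMod N).val) := by
    rw [groupMatrix_eq_sum]
    refine (Fintype.sum_equiv (unitPowEquiv hN K) _ _ fun g => ?_).symm
    simp only [unitPowEquiv, Equiv.coe_fn_mk, hf', pow_val_inv (hN g)]
  have h1 : ∀ a ∈ eigs hH, (groupMatrix f' * specProj (eigs hH) (c • groupMatrix f) a).trace =
      ψ K * (groupMatrix f * specProj (eigs hH) (c • groupMatrix f) a).trace := by
    intro a ha
    obtain ⟨x, hx, hx', e2, hxs⟩ := exists_trace_specProj hN ι hf hH ha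
    obtain ⟨D, hD⟩ := exists_natCast_eq_trace (isIdempotentElem_specProj (aeval_nodal_eigs hH) ha)
    obtain ⟨i, -, hi⟩ := Finset.mem_image.1 ha
    obtain ⟨q, hq⟩ := h i
    have hy : ∑ g, (f g : CyclotomicField N ℚ) * x g = (q : CyclotomicField N ℚ) * D * s := by
      apply ι.injective
      rw [map_mul, map_mul, map_ratCast, map_natCast]
      apply mul_left_cancel₀ hc
      rw [← hxs, hD, ← hi, hq]
      ring
    have hy' : cycAut K (∑ g, (f g : CyclotomicField N ℚ) * x g) =
        ψ K * ∑ g, (f g : CyclotomicField N ℚ) * x g := by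
      rw [hy, map_mul, map_mul, map_ratCast, map_natCast, hsψ]
      ring
    have e1 : (groupMatrix f' * specProj (eigs hH) (c • groupMatrix f) a).trace =
        ι (cycAut K (∑ g, (f g : CyclotomicField N ℚ) * x g)) := by
      rw [hF, Finset.sum_mul, Matrix.trace_sum, map_sum, map_sum]
      refine Finset.sum_congr rfl fun g _ => ?_
      rw [smul_mul_assoc, Matrix.trace_smul, map_mul, map_mul, hx', hx, map_intCast, map_intCast,
        smul_eq_mul]
    rw [e1, e2, hy', map_mul, map_intCast]
  have h2 : (groupMatrix f' * (c • groupMatrix f)).trace =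
      ψ K * (groupMatrix f * (c • groupMatrix f)).trace := by
    have h3 : c • groupMatrix f =
        ∑ a ∈ eigs hH, a • specProj (eigs hH) (c • groupMatrix f) a := by
      conv_lhs => rw [← mul_one (c • groupMatrix f),
        ← sum_specProj (S := eigs hH) (X := c • groupMatrix f) ⟨_, mem_eigs hH g⟩, Finset.mul_sum]
      exact Finset.sum_congr rfl fun a ha => mul_specProj (aeval_nodal_eigs hH) ha
    have h4 : ∀ Y : Matrix G G ℂ, (Y * (c • groupMatrix f)).trace =
        ∑ a ∈ eigs hH, a * (Y * specProj (eigs hH) (c • groupMatrix f) a).trace := by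
      intro Y
      refine (congrArg (fun Z => (Y * Z).trace) h3).trans ?_
      simp only [Finset.mul_sum, Matrix.trace_sum, mul_smul_comm, Matrix.trace_smul, smul_eq_mul]
    rw [h4, h4, Finset.mul_sum]
    exact Finset.sum_congr rfl fun a ha => by rw [h1 a ha]; ring
  have h4 : ∑ g, f' g * f g = ψ K * ∑ g, f g * f g := by
    rw [← hH.eq, Matrix.conjTranspose_smul, mul_smul_comm, mul_smul_comm, Matrix.trace_smul,
      Matrix.trace_smul, trace_groupMatrix_mul_conjTranspose, trace_groupMatrix_mul_conjTranspose,
      smul_eq_mul, smul_eq_mul] at h2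
    have hG : (Fintype.card G : ℂ) ≠ 0 := by exact_mod_cast Fintype.card_ne_zero
    have h3 : ((∑ g, f' g * f g : ℤ) : ℂ) = ψ K * ((∑ g, f g * f g : ℤ) : ℂ) := by
      apply mul_left_cancel₀ (mul_ne_zero (star_ne_zero.2 hc) hG)
      linear_combination h2
    exact_mod_cast h3
  have h5 : ∑ g, f' g * f' g = ∑ g, f g * f g :=
    Fintype.sum_equiv (unitPowEquiv hN K⁻¹) _ _ fun g => rfl
  have h6 : ∑ g, (f' g - ψ K * f g) ^ 2 = 0 := by
    have : ∀ g, (f' g - ψ K * f g) ^ 2 =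
        f' g * f' g - 2 * ψ K * (f' g * f g) + (ψ K) ^ 2 * (f g * f g) := fun g => by ring
    rw [Finset.sum_congr rfl fun g _ => this g, Finset.sum_add_distrib, Finset.sum_sub_distrib,
      ← Finset.mul_sum, ← Finset.mul_sum, h4, h5]
    rcases hψ K with h | h <;> rw [h] <;> ring
  have h7 := (Finset.sum_eq_zero_iff_of_nonneg fun g _ => sq_nonneg (f' g - ψ K * f g)).1 h6
    (g ^ (K : ZMod N).val) (Finset.mem_univ _)
  rw [sq_eq_zero_iff, sub_eq_zero, hf'] at h7
  simp only [pow_val_inv (hN g)] at h7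
  rcases hψ K with h | h <;> rw [h] at h7 ⊢ <;> linarith

end Eigenvalues

/-! ### Arithmetic of the common scale of the eigenvalues -/

section Scalars

/-- A positive real with rational square is a rational multiple of the root of a squarefree
number. -/
theorem exists_squarefree_of_sq_eq_rat {θ : ℝ} (hθ : 0 < θ) {r : ℚ} (h : θ ^ 2 = r) :
    ∃ d : ℕ, Squarefree d ∧ ∃ q : ℚ, θ = q * √d := by
  have hr : 0 < r := by
    have : (0 : ℝ) < r := h ▸ pow_pos hθ 2
    exact_mod_cast this
  -- Write `r = num * den / den²` and split `num * den` as `b² d`.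
  obtain ⟨d, b, hb, hd⟩ := Nat.sq_mul_squarefree (r.num.toNat * r.den)
  refine ⟨d, hd, b / r.den, ?_⟩
  have hden : (r.den : ℝ) ≠ 0 := by exact_mod_cast r.den_ne_zero
  have hnum : ((r.num.toNat : ℕ) : ℝ) = (r.num : ℝ) := by
    exact_mod_cast Int.toNat_of_nonneg (Rat.num_pos.2 hr).le
  have hb' : (b : ℝ) ^ 2 * d = r.num * r.den := by
    rw [← hnum]
    exact_mod_cast hb
  have hr' : (r : ℝ) = r.num / r.den := by exact_mod_cast (Rat.num_div_den r).symm
  rw [← sq_eq_sq₀ hθ.le (by push_cast; positivity), h, mul_pow, Real.sq_sqrt (Nat.cast_nonneg d)]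
  push_cast
  rw [hr', div_pow, div_mul_eq_mul_div, hb']
  field_simp

/-- A finite family of rationals has a common denominator. -/
theorem exists_common_denominator {ι : Type*} [Fintype ι] (q : ι → ℚ) :
    ∃ D : ℕ, 0 < D ∧ ∀ i, ∃ m : ℤ, (D : ℚ) * q i = m := by
  classical
  refine ⟨∏ i, (q i).den, Finset.prod_pos fun i _ => (q i).den_pos, fun i => ?_⟩
  refine ⟨(∏ j ∈ Finset.univ.erase i, ((q j).den : ℤ)) * (q i).num, ?_⟩
  rw [← Finset.mul_prod_erase Finset.univ (fun i => (q i).den) (Finset.mem_univ i)]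
  push_cast
  rw [mul_comm ((q i).den : ℚ), mul_assoc, mul_comm ((q i).den : ℚ), Rat.mul_den_eq_num]

end Scalars

section Hermitian

variable {V : Type*} [Fintype V] [DecidableEq V] {A : Matrix V V ℂ}

/-- If `exp (2itA)` is scalar and `A` has trace zero, then the eigenvalues of `A` are rational
multiples of `π / t`. -/
theorem eigenvalues_eq_rat_mul_of_exp [Nonempty V] (hA : A.IsHermitian) (htr : A.trace = 0) {t : ℝ}
    (ht : 0 < t) {α : ℂ}
    (h : NormedSpace.exp ((Complex.I * ((2 * t : ℝ) : ℂ)) • A) = α • (1 : Matrix V V ℂ)) (i : V) :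
    ∃ q : ℚ, hA.eigenvalues i = q * (Real.pi / t) := by
  have h1 := exp_eigenvalue_eq_of_exp_smul_eq_smul_one hA h
  have h2 : ∀ j, ∃ m : ℤ, hA.eigenvalues i - hA.eigenvalues j = m * (Real.pi / t) := by
    intro j
    obtain ⟨m, hm⟩ := Complex.exp_eq_exp_iff_exists_int.1 ((h1 i).trans (h1 j).symm)
    refine ⟨m, ?_⟩
    have h3 : Complex.I * (((2 * t : ℝ) : ℂ) * (hA.eigenvalues i - hA.eigenvalues j)) =
        Complex.I * (m * (2 * Real.pi)) := by
      linear_combination hm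
    have h4 : 2 * t * (hA.eigenvalues i - hA.eigenvalues j) = m * (2 * Real.pi) := by
      exact_mod_cast mul_left_cancel₀ Complex.I_ne_zero h3
    field_simp
    linear_combination h4 / 2
  choose m hm using h2
  -- Only differences of eigenvalues are known so far; summing them over `j` with trace zero
  -- isolates `|V|` times the `i`-th one.
  have h3 : ∑ j, hA.eigenvalues j = 0 := by
    have := hA.trace_eq_sum_eigenvalues
    rw [htr] at this
    exact Complex.ofReal_injective (by simpa using this.symm)
  have h4 : (Fintype.card V : ℝ) * hA.eigenvalues i = (∑ j, m j : ℤ) * (Real.pi / t) := by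
    have := Finset.sum_congr rfl fun j (_ : j ∈ Finset.univ) => hm j
    rw [Finset.sum_sub_distrib, h3, sub_zero, Finset.sum_const, Finset.card_univ, nsmul_eq_mul,
      ← Finset.sum_mul] at this
    rw [this]
    push_cast
    rfl
  have hV : (Fintype.card V : ℝ) ≠ 0 := by exact_mod_cast Fintype.card_ne_zero
  refine ⟨(∑ j, m j : ℤ) / Fintype.card V, ?_⟩
  push_cast at h4 ⊢
  rw [div_mul_eq_mul_div, eq_div_iff hV, ← h4, mul_comm]

theorem sum_sq_eigenvalues (hA : A.IsHermitian) :
    ((∑ i, hA.eigenvalues i ^ 2 : ℝ) : ℂ) = (A * A).trace := by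
  have := trace_aeval_of_isHermitian hA (Polynomial.X ^ 2)
  simp only [map_pow, Polynomial.aeval_X, Polynomial.eval_pow, Polynomial.eval_X] at this
  rw [← sq, this]
  push_cast
  rfl

/-- If all eigenvalues of `A` are rational multiples of `√d`, some positive multiple of the time
`2π / √d` is a period. -/
theorem exists_exp_eq_one_of_eigenvalues (hA : A.IsHermitian) {d : ℕ} (hd : 0 < d)
    (h : ∀ i, ∃ q : ℚ, hA.eigenvalues i = q * √d) :
    ∃ D : ℕ, 0 < D ∧ ∀ l : ℕ,
      NormedSpace.exp ((Complex.I * ((D * l * (2 * Real.pi / √d) : ℝ) : ℂ)) • A) = 1 := by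
  choose q hq using h
  obtain ⟨D, hD, hm⟩ := exists_common_denominator q
  refine ⟨D, hD, fun l => exp_smul_eq_one_of_isHermitian hA _ fun i => ?_⟩
  obtain ⟨m, hm⟩ := hm i
  have hm' : (D : ℝ) * q i = m := by exact_mod_cast hm
  have hd' : √(d : ℝ) ≠ 0 := (Real.sqrt_pos.2 (by exact_mod_cast hd)).ne'
  refine Complex.exp_eq_one_iff.2 ⟨m * l, ?_⟩
  have h1 : (D * l * (2 * Real.pi / √d)) * hA.eigenvalues i = (m * l) * (2 * Real.pi) := by
    rw [hq, ← hm']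
    field_simp
  have h2 : ((D * l * (2 * Real.pi / √d) : ℝ) : ℂ) * hA.eigenvalues i =
      (m * l) * (2 * Real.pi) := by
    exact_mod_cast congrArg (fun x : ℝ => (x : ℂ)) h1
  rw [mul_assoc, h2]
  push_cast
  ring

end Hermitian

/-! ### From one vertex to all vertices -/

section Translation

variable {G : Type*} [Group G] [Fintype G] [DecidableEq G]

/-- A walk whose matrix is invariant under right translations is periodic at one vertex only if its
transition matrix is scalar. -/
theorem transition_eq_smul_one_of_periodicAt {M : Matrix G G ℂ}
    (hM : ∀ a b x : G, M (a * x) (b * x) = M a b) {a : G} {t : ℝ} (h : PeriodicAt M a t) :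
    ∃ α : ℂ, transition M t = α • (1 : Matrix G G ℂ) := by
  obtain ⟨α, hα⟩ := h
  rw [Matrix.mulVec_single_one] at hα
  have hU : ∀ x b c : G, transition M t (b * x) (c * x) = transition M t b c := by
    intro x b c
    -- `T` is the permutation matrix of right translation by `x`. It commutes with `M`, hence with
    -- the exponential.
    set T : Matrix G G ℂ := Matrix.of fun a b => if b = a * x then 1 else 0 with hT
    have hl : ∀ (Y : Matrix G G ℂ) (b c : G), (T * Y) b c = Y (b * x) c := by
      intro Y b c
      simp [hT, Matrix.mul_apply]
    have hr : ∀ (Y : Matrix G G ℂ) (b c : G), (Y * T) b (c * x) = Y b c := by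
      intro Y b c
      simp [hT, Matrix.mul_apply]
    have hc : Commute T M := by
      ext b c
      obtain ⟨c, rfl⟩ : ∃ c', c = c' * x := ⟨c * x⁻¹, by group⟩
      rw [hl, hr, hM]
    have hc' : Commute T (transition M t) := (hc.smul_right _).exp_right
    have := congrFun (congrFun hc'.eq b) (c * x)
    rwa [hl, hr] at this
  refine ⟨α, ?_⟩
  ext b c
  -- This translation carries column `c` to column `a`, which is known.
  have h1 := hU (c⁻¹ * a) b c
  have h2 := congrFun hα (b * (c⁻¹ * a))
  rw [Matrix.col_apply, Pi.smul_apply, smul_eq_mul] at h2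
  rw [← h1, mul_inv_cancel_left, h2, Matrix.smul_apply, Matrix.one_apply, Pi.single_apply, smul_eq_mul]
  congr 1
  simp [← mul_assoc, mul_inv_eq_one]

omit [Group G] in
theorem periodicAt_of_transition_eq_one {M : Matrix G G ℂ} {t : ℝ} (h : transition M t = 1)
    (a : G) : PeriodicAt M a t :=
  ⟨1, by rw [h, Matrix.one_mulVec, one_smul]⟩

end Translation

/-! ### The transformation rule and eigenvalues in `ℚ√d` -/

section TransformsBy

variable {G : Type*} [Group G]

/-- `f (g ^ k)` is the value at `g` times the quadratic symbol of `k` attached to `Δ`; when `Δ` is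
not attached to `n`, the function is zero. -/
def TransformsBy (n : ℕ) (Δ : ℤ) (f : G → ℤ) : Prop :=
  (∀ e : DeltaExponents n, e.delta = Δ →
    ∀ (k : (ZMod n)ˣ) (g : G), f (g ^ (k : ZMod n).val) = e.symbol k * f g) ∧
  (¬ IsDelta n Δ → f = 0)

variable [Fintype G] [DecidableEq G] {f : G → ℤ} {c : ℂ} {ε : ℤ} {d : ℕ} {n : ℕ} [NeZero n]

/-- The uses are `c = 1` with a root of `d` and `c = i` with a root of `-d`; in both cases the
product is real. -/
theorem mul_map_sqrt_eq {z : ℂ} (hc : c ^ 2 = ε) (hε : ε ^ 2 = 1) (hz : z ^ 2 = ((ε * d : ℤ) : ℂ)) :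
    c * z = (√d : ℝ) ∨ c * z = -(√d : ℝ) := by
  refine sq_eq_sq_iff_eq_or_eq_neg.1 ?_
  rw [mul_pow, hc, hz, ← Complex.ofReal_pow, Real.sq_sqrt (Nat.cast_nonneg d)]
  have : (ε : ℂ) ^ 2 = 1 := by exact_mod_cast hε
  push_cast
  linear_combination (d : ℂ) * this

theorem TransformsBy.eigenvalues (hn : ∀ g : G, g ^ n = 1) (hc : c ^ 2 = ε) (hε : ε ^ 2 = 1)
    (hf : IsClassFun f) (hH : (c • groupMatrix f).IsHermitian) (h : TransformsBy n (ε * d) f)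
    (i : G) : ∃ q : ℚ, hH.eigenvalues i = q * √d := by
  by_cases hΔ : IsDelta n (ε * d)
  · obtain ⟨e, he⟩ := hΔ
    obtain ⟨s, hs, hsψ⟩ := e.hasSqrtWith_self
    have hs0 : s ≠ 0 := by
      rintro rfl
      exact e.delta_ne_zero (by exact_mod_cast (by simpa using hs.symm :
        ((e.delta : ℤ) : CyclotomicField n ℚ) = 0))
    obtain ⟨ι⟩ : Nonempty (CyclotomicField n ℚ →+* ℂ) := inferInstance
    obtain ⟨q, hq⟩ := eigenvalues_of_forall_apply_pow hn ι hs0 hsψ e.symbol_eq_one_or hf hH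
      (h.1 e he) i
    have hz : ι s ^ 2 = ((ε * d : ℤ) : ℂ) := by rw [← map_pow, hs, map_intCast, he]
    rcases mul_map_sqrt_eq hc hε hz with h1 | h1
    · refine ⟨q, ?_⟩
      have : (hH.eigenvalues i : ℂ) = ((q * √d : ℝ) : ℂ) := by
        rw [hq]; push_cast; linear_combination (q : ℂ) * h1
      exact_mod_cast this
    · refine ⟨-q, ?_⟩
      have : (hH.eigenvalues i : ℂ) = (((-q : ℚ) * √d : ℝ) : ℂ) := by
        rw [hq]; push_cast; linear_combination (q : ℂ) * h1
      exact_mod_cast this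
  · refine ⟨0, ?_⟩
    have h0 : groupMatrix f = 0 := by
      rw [h.2 hΔ]; ext; simp [groupMatrix]
    have h1 : hH.eigenvalues = 0 := hH.eigenvalues_eq_zero_iff.2 (by rw [h0, smul_zero])
    simp [h1]

/-- Modulo `8 * n * d` both `d` and `-d` are discriminants, so the rule holds there. It descends to
`n` because `f (g ^ K)` depends only on `K` modulo `n`. -/
theorem transformsBy_of_eigenvalues (hn : ∀ g : G, g ^ n = 1) (hc : c ^ 2 = ε) (hε : ε = 1 ∨ ε = -1)
    (hf : IsClassFun f) (hH : (c • groupMatrix f).IsHermitian) (hd : Squarefree d)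
    (h : ∀ i, ∃ q : ℚ, hH.eigenvalues i = q * √d) : TransformsBy n (ε * d) f := by
  have hn0 : n ≠ 0 := NeZero.ne n
  have : NeZero (8 * n * d) := ⟨by have := hd.ne_zero; positivity⟩
  have hnN : n ∣ 8 * n * d := ⟨8 * d, by ring⟩
  have hN : ∀ g : G, g ^ (8 * n * d) = 1 := fun g => by
    obtain ⟨m, hm⟩ := hnN
    rw [hm, pow_mul, hn, one_pow]
  have hΔ : IsDelta (8 * n * d) (ε * d) := by
    have := isDelta_of_squarefree (N := 8 * n * d) ⟨n * d, by ring⟩ (NeZero.ne _) hd ⟨8 * n, by ring⟩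
    rcases hε with rfl | rfl
    · simpa using this.1
    · simpa using this.2
  obtain ⟨E, hE⟩ := hΔ
  obtain ⟨s, hs, hsψ⟩ := E.hasSqrtWith_self
  obtain ⟨ι⟩ : Nonempty (CyclotomicField (8 * n * d) ℚ →+* ℂ) := inferInstance
  have hz : ι s ^ 2 = ((ε * d : ℤ) : ℂ) := by rw [← map_pow, hs, map_intCast, hE]
  have hc0 : c ≠ 0 := by
    rintro rfl
    rcases hε with rfl | rfl <;> norm_num at hc
  have hε2 : ε ^ 2 = 1 := by rcases hε with rfl | rfl <;> norm_num
  have hK := apply_pow_of_eigenvalues hN ι hc0 hsψ E.symbol_eq_one_or hf hH fun i => by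
    obtain ⟨q, hq⟩ := h i
    rcases mul_map_sqrt_eq hc hε2 hz with h1 | h1
    · refine ⟨q, ?_⟩
      rw [hq]; push_cast; linear_combination -(q : ℂ) * h1
    · refine ⟨-q, ?_⟩
      rw [hq]; push_cast; linear_combination (q : ℂ) * h1
  have hpow : ∀ (K : (ZMod (8 * n * d))ˣ) (g : G),
      g ^ ((ZMod.unitsMap hnN K : (ZMod n)ˣ) : ZMod n).val = g ^ (K : ZMod (8 * n * d)).val := by
    intro K g
    have := natCast_val_unitsMap hnN (dvd_refl n) K
    rw [ZMod.natCast_eq_natCast_iff] at this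
    exact pow_eq_pow_of_modEq this (hn g)
  refine ⟨fun e he k g => ?_, fun hΔ => ?_⟩
  · obtain ⟨K, rfl⟩ := ZMod.unitsMap_surjective hnN k
    rw [hpow, hK, DeltaExponents.symbol_eq_of_delta_eq hnN (he.trans hE.symm)]
  -- A unit `K` that is 1 modulo `n` with symbol `-1` gives `f g = -f g`.
  · rcases E.isDelta_or_exists_symbol_eq_neg_one hnN with h1 | ⟨K, hK1, hK2⟩
    · exact absurd (hE ▸ h1) hΔ
    · ext g
      have h1 := hK K g
      rw [← hpow, hK1, pow_val_one (hn g), hK2] at h1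
      simp only [Pi.zero_apply]
      omega

end TransformsBy

/-! ### Signed indicator functions -/

section SignFun

variable {G : Type*} [Group G] {C D : Set G}

/-- The function that is `1` on `C`, `-1` on `D` and `0` elsewhere, for disjoint `C` and `D`. -/
noncomputable def signFun (C D : Set G) : G → ℤ := C.indicator 1 - D.indicator 1

omit [Group G] in
theorem signFun_eq_one_iff (h : Disjoint C D) {g : G} : signFun C D g = 1 ↔ g ∈ C := by
  have h' : g ∈ C → g ∉ D := fun h1 h2 => Set.disjoint_left.1 h h1 h2
  by_cases h1 : g ∈ C <;> by_cases h2 : g ∈ D <;> simp_all [signFun]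

omit [Group G] in
theorem signFun_eq_neg_one_iff (h : Disjoint C D) {g : G} : signFun C D g = -1 ↔ g ∈ D := by
  have h' : g ∈ C → g ∉ D := fun h1 h2 => Set.disjoint_left.1 h h1 h2
  by_cases h1 : g ∈ C <;> by_cases h2 : g ∈ D <;> simp_all [signFun]

omit [Group G] in
theorem eq_empty_of_signFun_eq_zero (h : Disjoint C D) (h0 : signFun C D = 0) : C = ∅ ∧ D = ∅ := by
  constructor <;> refine Set.eq_empty_of_forall_notMem fun g hg => ?_
  · have := (signFun_eq_one_iff h).2 hg
    simp [h0] at this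
  · have := (signFun_eq_neg_one_iff h).2 hg
    simp [h0] at this

omit [Group G] in
theorem signFun_congr {g g' : G} (hC : g' ∈ C ↔ g ∈ C) (hD : g' ∈ D ↔ g ∈ D) :
    signFun C D g' = signFun C D g := by
  classical
  simp [signFun, Set.indicator_apply, hC, hD]

omit [Group G] in
theorem signFun_swap {g g' : G} (hC : g' ∈ C ↔ g ∈ D) (hD : g' ∈ D ↔ g ∈ C) :
    signFun C D g' = -signFun C D g := by
  classical
  simp [signFun, Set.indicator_apply, hC, hD]

theorem IsNormalSet.conj_mem_iff (hC : IsNormalSet C) (g x : G) : x * g * x⁻¹ ∈ C ↔ g ∈ C := by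
  refine ⟨fun h => ?_, fun h => hC g h x⟩
  have := hC _ h x⁻¹
  rwa [show x⁻¹ * (x * g * x⁻¹) * x⁻¹⁻¹ = g by group] at this

theorem IsNormalSet.inv (hC : IsNormalSet C) : IsNormalSet C⁻¹ := by
  intro g hg x
  rw [Set.mem_inv] at hg ⊢
  rw [show (x * g * x⁻¹)⁻¹ = x * g⁻¹ * x⁻¹ by group]
  exact hC _ hg x

theorem isClassFun_signFun (hC : IsNormalSet C) (hD : IsNormalSet D) : IsClassFun (signFun C D) :=
  fun g x => signFun_congr (hC.conj_mem_iff g x) (hD.conj_mem_iff g x)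

theorem groupMatrix_signFun (C D : Set G) :
    groupMatrix (signFun C D) = cayleyMatrix C - cayleyMatrix D := by
  classical
  ext a b
  simp [groupMatrix, signFun, cayleyMatrix, Set.indicator_apply]

end SignFun

/-! ### Transformation rules as conditions on classes -/

section Classes

variable {G : Type*} [Group G] [Finite G] {C D : Set G}

local instance exponentNeZero : NeZero (Monoid.exponent G) := ⟨Monoid.exponent_ne_zero_of_finite⟩

theorem DeltaExponents.symbol_inv {n : ℕ} [NeZero n] (e : DeltaExponents n) (k : (ZMod n)ˣ) :
    e.symbol k⁻¹ = e.symbol k := by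
  have h := e.symbol_mul k k⁻¹
  rw [mul_inv_cancel, e.symbol_one] at h
  rcases e.symbol_eq_one_or k with h1 | h1 <;> rw [h1] at h ⊢ <;> linarith

omit [Finite G] in
theorem isUnionOfClasses_empty (Δ : ℤ) : IsUnionOfClasses Δ (∅ : Set G) := ⟨∅, by simp⟩

theorem IsUnionOfClasses.pow_mem_iff {e : DeltaExponents (Monoid.exponent G)}
    (hC : IsUnionOfClasses e.delta C) {k : (ZMod (Monoid.exponent G))ˣ} (hk : e.symbol k = 1)
    (g : G) : g ^ (k : ZMod (Monoid.exponent G)).val ∈ C ↔ g ∈ C := by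
  obtain ⟨S, rfl⟩ := hC
  have key : ∀ (l : (ZMod (Monoid.exponent G))ˣ) (g : G), e.symbol l = 1 →
      g ∈ (⋃ h ∈ S, {g | DeltaRel e.delta g h}) →
      g ^ (l : ZMod (Monoid.exponent G)).val ∈ ⋃ h ∈ S, {g | DeltaRel e.delta g h} := by
    intro l g hl hg
    simp only [Set.mem_iUnion, Set.mem_ofPred_eq] at hg ⊢
    obtain ⟨h, hS, m, hm, hconj⟩ := hg
    refine ⟨h, hS, m * l, ?_, ?_⟩
    · rw [e.mem_H_iff] at hm ⊢
      rw [e.symbol_mul, hm, hl, one_mul]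
    · rw [pow_val_mul (Monoid.pow_exponent_eq_one h)]
      exact hconj.pow _
  refine ⟨fun h => ?_, key k g hk⟩
  have := key k⁻¹ _ (by rw [e.symbol_inv, hk]) h
  rwa [pow_val_inv (Monoid.pow_exponent_eq_one g)] at this

theorem isUnionOfClasses_of_pow_mem {e : DeltaExponents (Monoid.exponent G)} (hC : IsNormalSet C)
    (h : ∀ k : (ZMod (Monoid.exponent G))ˣ, e.symbol k = 1 →
      ∀ g ∈ C, g ^ (k : ZMod (Monoid.exponent G)).val ∈ C) : IsUnionOfClasses e.delta C := by
  refine ⟨C, Set.Subset.antisymm (fun g hg => ?_) fun g hg => ?_⟩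
  · simp only [Set.mem_iUnion, Set.mem_ofPred_eq]
    refine ⟨g, hg, 1, (e.mem_H_iff 1).2 e.symbol_one, ?_⟩
    rw [pow_val_one (Monoid.pow_exponent_eq_one g)]
  · simp only [Set.mem_iUnion, Set.mem_ofPred_eq] at hg
    obtain ⟨x, hx, k, hk, hconj⟩ := hg
    obtain ⟨y, hy⟩ := isConj_iff.1 hconj
    exact (hC.conj_mem_iff g y).1 (hy ▸ h k ((e.mem_H_iff k).1 hk) x hx)

omit [Finite G] in
theorem eq_powSet_iff (k : (ZMod (Monoid.exponent G))ˣ) :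
    C = powSet D k ↔ ∀ g : G, g ^ (k : ZMod (Monoid.exponent G)).val ∈ C ↔ g ∈ D := by
  have hinv := fun g : G => pow_val_inv (Monoid.pow_exponent_eq_one g) k
  have hinv' := fun g : G => pow_val_inv' (Monoid.pow_exponent_eq_one g) k
  constructor
  · rintro rfl g
    refine ⟨?_, fun h => ⟨g, h, rfl⟩⟩
    rintro ⟨y, hy, hyg⟩
    have h1 := hinv y
    rw [show y ^ (k : ZMod (Monoid.exponent G)).val = _ from hyg, hinv] at h1
    rwa [h1]
  · intro h
    ext g
    constructor
    · intro hg
      rw [← hinv' g, h] at hg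
      exact ⟨_, hg, hinv' g⟩
    · rintro ⟨y, hy, rfl⟩
      exact (h y).2 hy

/-- Both `k₀⁻¹ * k` and `k * k₀` have symbol 1, so they preserve `C`. The first replaces `k₀` by
`k`; the second shows that `k` also takes `D` back to `C`. -/
theorem pow_mem_iff_of_symbol_eq_neg_one {e : DeltaExponents (Monoid.exponent G)}
    (hC : IsUnionOfClasses e.delta C) {k₀ k : (ZMod (Monoid.exponent G))ˣ}
    (h₀ : e.symbol k₀ = -1) (hk : e.symbol k = -1) (h : C = powSet D k₀) (g : G) :
    (g ^ (k : ZMod (Monoid.exponent G)).val ∈ C ↔ g ∈ D) ∧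
      (g ^ (k : ZMod (Monoid.exponent G)).val ∈ D ↔ g ∈ C) := by
  rw [eq_powSet_iff] at h
  constructor
  · have h1 : e.symbol (k₀⁻¹ * k) = 1 := by
      rw [e.symbol_mul, e.symbol_inv, h₀, hk]; norm_num
    rw [← h, ← hC.pow_mem_iff h1 (g ^ (k₀ : ZMod (Monoid.exponent G)).val),
      ← pow_val_mul (Monoid.pow_exponent_eq_one g),
      mul_inv_cancel_left]
  · have h1 : e.symbol (k * k₀) = 1 := by
      rw [e.symbol_mul, h₀, hk]; norm_num
    rw [← h, ← hC.pow_mem_iff h1 g, pow_val_mul (Monoid.pow_exponent_eq_one g)]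

theorem DeltaExponents.notMem_H_iff {n : ℕ} [NeZero n] (e : DeltaExponents n) (k : (ZMod n)ˣ) :
    k ∉ H n e.delta ↔ e.symbol k = -1 := by
  rw [e.mem_H_iff]
  rcases e.symbol_eq_one_or k with h | h <;> rw [h] <;> norm_num

theorem exists_powSet_iff_forall {Δ : ℤ} (hΔ : IsDelta (Monoid.exponent G) Δ) (h1 : Δ ≠ 1)
    (hC : IsUnionOfClasses Δ C) :
    (∃ k : (ZMod (Monoid.exponent G))ˣ, k ∉ H (Monoid.exponent G) Δ ∧ C = powSet D k) ↔
      ∀ k : (ZMod (Monoid.exponent G))ˣ, k ∉ H (Monoid.exponent G) Δ → C = powSet D k := by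
  obtain ⟨e, rfl⟩ := hΔ
  simp only [e.notMem_H_iff]
  constructor
  · rintro ⟨k₀, h₀, h⟩ k hk
    exact (eq_powSet_iff k).2 fun g => (pow_mem_iff_of_symbol_eq_neg_one hC h₀ hk h g).1
  · intro h
    obtain ⟨k, hk⟩ := e.exists_symbol_eq_neg_one h1
    exact ⟨k, hk, h k hk⟩

variable {Ci C1 Cm : Set G}

/-- The description of the connection sets of a periodic graph. -/
def SatisfiesDeltaCondition (Ci C1 Cm : Set G) : Prop :=
  ∃ Δ : ℤ, IsDelta (Monoid.exponent G) Δ ∧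
    (IsDelta (Monoid.exponent G) (-|Δ|) → IsUnionOfClasses (-|Δ|) Ci) ∧
    (¬ IsDelta (Monoid.exponent G) (-|Δ|) → Ci = ∅) ∧
    (IsDelta (Monoid.exponent G) |Δ| →
      IsUnionOfClasses |Δ| C1 ∧ IsUnionOfClasses |Δ| Cm ∧
      (Δ ≠ 1 → ∃ k : (ZMod (Monoid.exponent G))ˣ,
        k ∉ H (Monoid.exponent G) |Δ| ∧ C1 = powSet Cm k)) ∧
    (¬ IsDelta (Monoid.exponent G) |Δ| → C1 = ∅ ∧ Cm = ∅)

theorem SatisfiesDeltaCondition.exists_transformsBy (h : SatisfiesDeltaCondition Ci C1 Cm) :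
    ∃ d : ℕ, 0 < d ∧ TransformsBy (Monoid.exponent G) d (signFun C1 Cm) ∧
      TransformsBy (Monoid.exponent G) (-d) (signFun Ci Ci⁻¹) := by
  obtain ⟨Δ, ⟨e, rfl⟩, hi, hi', hr, hr'⟩ := h
  refine ⟨e.delta.natAbs, Int.natAbs_pos.2 e.delta_ne_zero, ?_, ?_⟩ <;>
    rw [Int.natCast_natAbs]
  · refine ⟨fun e' he k g => ?_, fun hΔ => ?_⟩
    · obtain ⟨h1, hm, hk⟩ := hr ⟨e', he⟩
      rw [← he] at h1 hm hk
      rcases e'.symbol_eq_one_or k with h | h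
      · rw [h, one_mul]
        exact signFun_congr (h1.pow_mem_iff h g) (hm.pow_mem_iff h g)
      -- For `Δ = 1` no unit has symbol `-1`, so the swap condition is available whenever it is
      -- needed.
      · have hne : e.delta ≠ 1 := by
          intro h'
          rw [h', abs_one] at he
          rw [e'.symbol_eq_one_of_delta_eq_one he] at h
          norm_num at h
        obtain ⟨k₀, h₀, hk⟩ := hk hne
        have := pow_mem_iff_of_symbol_eq_neg_one h1 ((e'.notMem_H_iff k₀).1 h₀) h hk g
        rw [h, neg_one_mul]
        exact signFun_swap this.1 this.2
    · obtain ⟨rfl, rfl⟩ := hr' hΔ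
      simp [signFun]
  · refine ⟨fun e' he k g => ?_, fun hΔ => ?_⟩
    · have h1 := hi ⟨e', he⟩
      rw [← he] at h1
      -- As the discriminant is negative, `-k` has symbol 1 whenever `k` has symbol `-1`. Such `k`
      -- therefore exchange `C(i)` and `C(i)⁻¹` automatically, and no separate swap condition is
      -- needed.
      have hneg : e'.symbol (-1) = -1 := e'.symbol_neg_one (by
        rw [he, neg_lt_zero, abs_pos]; exact e.delta_ne_zero)
      rcases e'.symbol_eq_one_or k with h | h
      · rw [h, one_mul]
        refine signFun_congr (h1.pow_mem_iff h g) ?_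
        rw [Set.mem_inv, Set.mem_inv, ← inv_pow, h1.pow_mem_iff h]
      · have h2 : e'.symbol (-1 * k) = 1 := by rw [e'.symbol_mul, hneg, h]; norm_num
        have h3 : ∀ x : G, x⁻¹ ^ (k : ZMod (Monoid.exponent G)).val ∈ Ci ↔ x ∈ Ci := by
          intro x
          rw [← pow_val_neg_one (Monoid.pow_exponent_eq_one x),
            ← pow_val_mul (Monoid.pow_exponent_eq_one x), h1.pow_mem_iff h2]
        rw [h, neg_one_mul]
        refine signFun_swap ?_ ?_
        · rw [Set.mem_inv, ← h3 g⁻¹, inv_inv]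
        · rw [Set.mem_inv, ← inv_pow, h3]
    · rw [hi' hΔ]
      simp [signFun]

theorem IsNormalMixed.satisfiesDeltaCondition (hC : IsNormalMixed Ci C1 Cm) {d : ℕ}
    (hr : TransformsBy (Monoid.exponent G) d (signFun C1 Cm))
    (hi : TransformsBy (Monoid.exponent G) (-d) (signFun Ci Ci⁻¹)) :
    SatisfiesDeltaCondition Ci C1 Cm := by
  have ui : IsDelta (Monoid.exponent G) (-(d : ℤ)) → IsUnionOfClasses (-(d : ℤ)) Ci := by
    rintro ⟨e, he⟩
    rw [← he]
    refine isUnionOfClasses_of_pow_mem hC.normal_i fun k hk g hg => ?_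
    have := hi.1 e he k g
    rw [hk, one_mul, (signFun_eq_one_iff hC.disj_i_inv).2 hg] at this
    exact (signFun_eq_one_iff hC.disj_i_inv).1 this
  have u1 : IsDelta (Monoid.exponent G) (d : ℤ) →
      IsUnionOfClasses (d : ℤ) C1 ∧ IsUnionOfClasses (d : ℤ) Cm ∧
      ((d : ℤ) ≠ 1 → ∃ k : (ZMod (Monoid.exponent G))ˣ,
        k ∉ H (Monoid.exponent G) d ∧ C1 = powSet Cm k) := by
    rintro ⟨e, he⟩
    rw [← he]
    refine ⟨isUnionOfClasses_of_pow_mem hC.normal_one fun k hk g hg => ?_,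
      isUnionOfClasses_of_pow_mem hC.normal_neg fun k hk g hg => ?_, fun hd => ?_⟩
    · have := hr.1 e he k g
      rw [hk, one_mul, (signFun_eq_one_iff hC.disj_one_neg).2 hg] at this
      exact (signFun_eq_one_iff hC.disj_one_neg).1 this
    · have := hr.1 e he k g
      rw [hk, one_mul, (signFun_eq_neg_one_iff hC.disj_one_neg).2 hg] at this
      exact (signFun_eq_neg_one_iff hC.disj_one_neg).1 this
    · obtain ⟨k, hk⟩ := e.exists_symbol_eq_neg_one hd
      refine ⟨k, (e.notMem_H_iff k).2 hk, (eq_powSet_iff k).2 fun g => ?_⟩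
      rw [← signFun_eq_one_iff hC.disj_one_neg, ← signFun_eq_neg_one_iff hC.disj_one_neg,
        hr.1 e he k g, hk]
      constructor <;> intro h <;> linarith
  have ei : ¬ IsDelta (Monoid.exponent G) (-(d : ℤ)) → Ci = ∅ := fun h =>
    (eq_empty_of_signFun_eq_zero hC.disj_i_inv (hi.2 h)).1
  have e1 : ¬ IsDelta (Monoid.exponent G) (d : ℤ) → C1 = ∅ ∧ Cm = ∅ := fun h =>
    eq_empty_of_signFun_eq_zero hC.disj_one_neg (hr.2 h)
  -- The positive sign is preferred: for `d = 1` the choice `Δ = -1` would demand a unit outside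
  -- `H_1`, which contains all units. If neither sign is a discriminant, all sets are empty and `Δ =
  -- 1` serves.
  by_cases hd : IsDelta (Monoid.exponent G) d
  · exact ⟨d, hd, by rwa [Nat.abs_cast], by rwa [Nat.abs_cast], by rwa [Nat.abs_cast],
      by rwa [Nat.abs_cast]⟩
  by_cases hd' : IsDelta (Monoid.exponent G) (-d)
  · exact ⟨-d, hd', by rwa [abs_neg, Nat.abs_cast], by rwa [abs_neg, Nat.abs_cast],
      by rw [abs_neg, Nat.abs_cast]; exact fun h => absurd h hd, by rwa [abs_neg, Nat.abs_cast]⟩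
  · obtain ⟨rfl, rfl⟩ := e1 hd
    obtain rfl := ei hd'
    exact ⟨1, isDelta_one _, fun _ => isUnionOfClasses_empty _, fun _ => rfl,
      fun _ => ⟨isUnionOfClasses_empty _, isUnionOfClasses_empty _, fun h => absurd rfl h⟩,
      fun _ => ⟨rfl, rfl⟩⟩

end Classes

/-! ### The matrix of the mixed graph and its period -/

section Mixed

variable {G : Type*} [Group G] {Ci C1 Cm : Set G}

theorem mixedMatrix_eq (Ci C1 Cm : Set G) :
    mixedMatrix Ci C1 Cm = (1 : ℂ) • groupMatrix (signFun C1 Cm) +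
      Complex.I • groupMatrix (signFun Ci Ci⁻¹) := by
  rw [mixedMatrix, groupMatrix_signFun, groupMatrix_signFun, one_smul]
  abel

namespace IsNormalMixed

variable (hC : IsNormalMixed Ci C1 Cm)
include hC

theorem isClassFun_real : IsClassFun (signFun C1 Cm) :=
  isClassFun_signFun hC.normal_one hC.normal_neg

theorem isClassFun_imag : IsClassFun (signFun Ci Ci⁻¹) :=
  isClassFun_signFun hC.normal_i hC.normal_i.inv

theorem signFun_real_inv (g : G) : signFun C1 Cm g⁻¹ = signFun C1 Cm g :=
  signFun_congr (by rw [← Set.mem_inv, hC.inv_one]) (by rw [← Set.mem_inv, hC.inv_neg])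

omit hC in
theorem signFun_imag_inv (Ci : Set G) (g : G) : signFun Ci Ci⁻¹ g⁻¹ = -signFun Ci Ci⁻¹ g :=
  signFun_swap (by rw [Set.mem_inv]) (by rw [Set.mem_inv, inv_inv])

theorem isHermitian_real : ((1 : ℂ) • groupMatrix (signFun C1 Cm)).IsHermitian := by
  rw [one_smul, Matrix.IsHermitian, groupMatrix_conjTranspose]
  simp only [hC.signFun_real_inv]

omit hC in
theorem isHermitian_imag (Ci : Set G) :
    (Complex.I • groupMatrix (signFun Ci Ci⁻¹)).IsHermitian := by
  rw [Matrix.IsHermitian, Matrix.conjTranspose_smul, groupMatrix_conjTranspose]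
  simp only [signFun_imag_inv]
  ext a b
  simp [groupMatrix]

theorem mixedMatrix_transpose : (mixedMatrix Ci C1 Cm).transpose =
    (1 : ℂ) • groupMatrix (signFun C1 Cm) - Complex.I • groupMatrix (signFun Ci Ci⁻¹) := by
  rw [mixedMatrix_eq, Matrix.transpose_add, Matrix.transpose_smul, Matrix.transpose_smul,
    groupMatrix_transpose, groupMatrix_transpose]
  simp only [hC.signFun_real_inv, signFun_imag_inv]
  ext a b
  simp [groupMatrix, sub_eq_add_neg]

omit hC in
theorem mixedMatrix_mul_right (a b x : G) :
    mixedMatrix Ci C1 Cm (a * x) (b * x) = mixedMatrix Ci C1 Cm a b := by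
  simp [mixedMatrix, cayleyMatrix]

variable [Fintype G] [DecidableEq G]

-- The integer on the right is what forces the square of the common scale `π / t` to be rational.
omit hC in
theorem sum_sq_eigenvalues_groupMatrix {f : G → ℤ} {c : ℂ} (hc : c * star c = 1)
    (hH : (c • groupMatrix f).IsHermitian) :
    ∑ i, hH.eigenvalues i ^ 2 = Fintype.card G * (∑ g, f g * f g : ℤ) := by
  have h := sum_sq_eigenvalues hH
  have h2 : (c • groupMatrix f) * (c • groupMatrix f) =
      (c * star c) • (groupMatrix f * (groupMatrix f).conjTranspose) := by
    conv_lhs => enter [2]; rw [← hH.eq]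
    rw [Matrix.conjTranspose_smul, smul_mul_smul_comm]
  rw [h2, hc, one_smul, trace_groupMatrix_mul_conjTranspose] at h
  exact_mod_cast h

/-- The transpose has the same scalar exponential. Since it equals `A - B` and commutes with `A +
B`, the sum and difference of the two exponents separate `A` from `B`, at the cost of doubling `t`.
-/
theorem eigenvalues_eq_rat_mul {t : ℝ} (ht : 0 < t) {α : ℂ}
    (h : transition (mixedMatrix Ci C1 Cm) t = α • (1 : Matrix G G ℂ)) :
    (∀ i, ∃ q : ℚ, hC.isHermitian_real.eigenvalues i = q * (Real.pi / t)) ∧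
      ∀ i, ∃ q : ℚ, (isHermitian_imag Ci).eigenvalues i = q * (Real.pi / t) := by
  set A := (1 : ℂ) • groupMatrix (signFun C1 Cm) with hA
  set B := Complex.I • groupMatrix (signFun Ci Ci⁻¹) with hB
  have hc : Commute A B := (hC.isClassFun_real.commute.smul_left _).smul_right _
  set X := (Complex.I * (t : ℂ)) • mixedMatrix Ci C1 Cm with hX
  set Y := (Complex.I * (t : ℂ)) • (mixedMatrix Ci C1 Cm).transpose with hY
  have hX' : NormedSpace.exp X = α • (1 : Matrix G G ℂ) := h
  have hY' : NormedSpace.exp Y = α • (1 : Matrix G G ℂ) := by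
    rw [hY, ← Matrix.transpose_smul, Matrix.exp_transpose, ← hX, hX', Matrix.transpose_smul,
      Matrix.transpose_one]
  have hM : mixedMatrix Ci C1 Cm = A + B := mixedMatrix_eq Ci C1 Cm
  have hT : (mixedMatrix Ci C1 Cm).transpose = A - B := hC.mixedMatrix_transpose
  have hXY : Commute X Y := by
    rw [hX, hY, hT, hM]
    exact ((((Commute.refl A).sub_right hc).add_left (hc.symm.sub_right (Commute.refl B))).smul_left
      _).smul_right _
  have h1 : NormedSpace.exp ((Complex.I * ((2 * t : ℝ) : ℂ)) • A) =
      (α * α) • (1 : Matrix G G ℂ) := by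
    have : (Complex.I * ((2 * t : ℝ) : ℂ)) • A = X + Y := by
      rw [hX, hY, hT, hM]; push_cast; module
    rw [this, Matrix.exp_add_of_commute _ _ hXY, hX', hY', smul_mul_smul_comm, one_mul]
  have h2 : NormedSpace.exp ((Complex.I * ((2 * t : ℝ) : ℂ)) • B) =
      (1 : ℂ) • (1 : Matrix G G ℂ) := by
    have : (Complex.I * ((2 * t : ℝ) : ℂ)) • B = X + -Y := by
      rw [hX, hY, hT, hM]; push_cast; module
    rw [this, Matrix.exp_add_of_commute _ _ hXY.neg_right, hX', ← hY',
      ← Matrix.exp_add_of_commute _ _ (Commute.refl Y).neg_right, add_neg_cancel,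
      NormedSpace.exp_zero, one_smul]
  have hA0 : A.trace = 0 := by
    classical
    rw [hA, one_smul, trace_groupMatrix]
    simp [signFun, hC.one_notMem_one, hC.one_notMem_neg]
  -- The identity may not be excluded from `C(i)` explicitly, but the function is odd under
  -- inversion and so vanishes at 1.
  have hB0 : B.trace = 0 := by
    have := signFun_imag_inv Ci 1
    rw [_root_.inv_one] at this
    rw [hB, Matrix.trace_smul, trace_groupMatrix, show signFun Ci Ci⁻¹ 1 = 0 by omega]
    simp
  exact ⟨eigenvalues_eq_rat_mul_of_exp _ hA0 ht h1, eigenvalues_eq_rat_mul_of_exp _ hB0 ht h2⟩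

theorem exists_transformsBy {t : ℝ} (ht : 0 < t) {α : ℂ}
    (h : transition (mixedMatrix Ci C1 Cm) t = α • (1 : Matrix G G ℂ)) :
    ∃ d : ℕ, TransformsBy (Monoid.exponent G) d (signFun C1 Cm) ∧
      TransformsBy (Monoid.exponent G) (-d) (signFun Ci Ci⁻¹) := by
  have : NeZero (Monoid.exponent G) := ⟨Monoid.exponent_ne_zero_of_finite⟩
  obtain ⟨hA, hB⟩ := hC.eigenvalues_eq_rat_mul ht h
  choose p hp using hA
  choose q hq using hB
  have hθ : 0 < Real.pi / t := div_pos Real.pi_pos ht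
  have hsumA := sum_sq_eigenvalues_groupMatrix (by simp) hC.isHermitian_real
  have hsumB := sum_sq_eigenvalues_groupMatrix (by simp) (isHermitian_imag Ci)
  obtain ⟨d, hd, hdA, hdB⟩ : ∃ d : ℕ, Squarefree d ∧
      (∀ i, ∃ q : ℚ, hC.isHermitian_real.eigenvalues i = q * √d) ∧
      (∀ i, ∃ q : ℚ, (isHermitian_imag Ci).eigenvalues i = q * √d) := by
    set Q : ℚ := ∑ i, p i ^ 2 + ∑ i, q i ^ 2 with hQ
    set m : ℤ := Fintype.card G * (∑ g, signFun C1 Cm g * signFun C1 Cm g) +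
      Fintype.card G * (∑ g, signFun Ci Ci⁻¹ g * signFun Ci Ci⁻¹ g) with hm
    have key : (Q : ℝ) * (Real.pi / t) ^ 2 = m := by
      simp only [hp, mul_pow, ← Finset.sum_mul] at hsumA
      simp only [hq, mul_pow, ← Finset.sum_mul] at hsumB
      rw [hQ, hm]
      push_cast at hsumA hsumB ⊢
      rw [add_mul, hsumA, hsumB]
    -- If all eigenvalues vanish, nothing is known about `π / t`, and `d = 1` works with zero
    -- coefficients.
    by_cases hQ0 : Q = 0
    · have h0 : ∀ i, p i = 0 ∧ q i = 0 := by
        have h1 := (add_eq_zero_iff_of_nonneg (Finset.sum_nonneg fun i _ => sq_nonneg (p i))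
          (Finset.sum_nonneg fun i _ => sq_nonneg (q i))).1 hQ0
        intro i
        have h2 := (Finset.sum_eq_zero_iff_of_nonneg fun i _ => sq_nonneg (p i)).1 h1.1 i
          (Finset.mem_univ i)
        have h3 := (Finset.sum_eq_zero_iff_of_nonneg fun i _ => sq_nonneg (q i)).1 h1.2 i
          (Finset.mem_univ i)
        exact ⟨sq_eq_zero_iff.1 h2, sq_eq_zero_iff.1 h3⟩
      exact ⟨1, squarefree_one, fun i => ⟨0, by rw [hp, (h0 i).1]; simp⟩,
        fun i => ⟨0, by rw [hq, (h0 i).2]; simp⟩⟩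
    · have hQ0' : (Q : ℝ) ≠ 0 := by exact_mod_cast hQ0
      obtain ⟨d, hd, r, hr⟩ := exists_squarefree_of_sq_eq_rat hθ (r := m / Q) (by
        push_cast
        rw [eq_div_iff hQ0', mul_comm, key])
      refine ⟨d, hd, fun i => ⟨p i * r, ?_⟩, fun i => ⟨q i * r, ?_⟩⟩
      · rw [hp, hr]; push_cast; ring
      · rw [hq, hr]; push_cast; ring
  refine ⟨d, ?_, ?_⟩
  · simpa using transformsBy_of_eigenvalues (ε := 1) Monoid.pow_exponent_eq_one (by simp)
      (Or.inl rfl) hC.isClassFun_real hC.isHermitian_real hd hdA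
  · simpa using transformsBy_of_eigenvalues (ε := -1) Monoid.pow_exponent_eq_one (by simp)
      (Or.inr rfl) hC.isClassFun_imag (isHermitian_imag Ci) hd hdB

theorem exists_transition_eq_one {d : ℕ} (hd : 0 < d)
    (hr : TransformsBy (Monoid.exponent G) d (signFun C1 Cm))
    (hi : TransformsBy (Monoid.exponent G) (-d) (signFun Ci Ci⁻¹)) :
    ∃ t : ℝ, 0 < t ∧ transition (mixedMatrix Ci C1 Cm) t = 1 := by
  have : NeZero (Monoid.exponent G) := ⟨Monoid.exponent_ne_zero_of_finite⟩
  obtain ⟨D, hD, hA⟩ := exists_exp_eq_one_of_eigenvalues hC.isHermitian_real hd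
    (TransformsBy.eigenvalues (ε := 1) Monoid.pow_exponent_eq_one (by simp) (by norm_num)
      hC.isClassFun_real hC.isHermitian_real (by simpa using hr))
  obtain ⟨E, hE, hB⟩ := exists_exp_eq_one_of_eigenvalues (isHermitian_imag Ci) hd
    (TransformsBy.eigenvalues (ε := -1) Monoid.pow_exponent_eq_one (by simp) (by norm_num)
      hC.isClassFun_imag (isHermitian_imag Ci) (by simpa using hi))
  have hs : 0 < √(d : ℝ) := Real.sqrt_pos.2 (by exact_mod_cast hd)
  -- A common multiple of the periods found for the two commuting parts.
  refine ⟨D * E * (2 * Real.pi / √d), by positivity, ?_⟩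
  rw [transition, mixedMatrix_eq, smul_add, Matrix.exp_add_of_commute, hA, one_mul,
    mul_comm (D : ℝ), hB]
  exact ((hC.isClassFun_real.commute.smul_left _).smul_right _).smul_left _ |>.smul_right _

end IsNormalMixed

end Mixed

end CayleyWalk

theorem mainTheorem3 {G : Type*} [Group G] [Fintype G] [DecidableEq G] (Ci C1 Cm : Set G)
    (hC : CayleyWalk.IsNormalMixed Ci C1 Cm) :
    List.TFAE [
      -- the walk is periodic at some vertex
      ∃ a : G, ∃ t : ℝ, 0 < t ∧ CayleyWalk.PeriodicAt (CayleyWalk.mixedMatrix Ci C1 Cm) a t,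
      -- the walk is periodic at all vertices, at a common time
      ∃ t : ℝ, 0 < t ∧ ∀ a : G, CayleyWalk.PeriodicAt (CayleyWalk.mixedMatrix Ci C1 Cm) a t,
      -- the description of the connection sets
      ∃ Δ : ℤ, CayleyWalk.IsDelta (Monoid.exponent G) Δ ∧
        (CayleyWalk.IsDelta (Monoid.exponent G) (-|Δ|) →
          CayleyWalk.IsUnionOfClasses (-|Δ|) Ci) ∧
        (¬ CayleyWalk.IsDelta (Monoid.exponent G) (-|Δ|) → Ci = ∅) ∧
        (CayleyWalk.IsDelta (Monoid.exponent G) |Δ| →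
          CayleyWalk.IsUnionOfClasses |Δ| C1 ∧ CayleyWalk.IsUnionOfClasses |Δ| Cm ∧
          (Δ ≠ 1 → ∃ k : (ZMod (Monoid.exponent G))ˣ,
            k ∉ CayleyWalk.H (Monoid.exponent G) |Δ| ∧ C1 = CayleyWalk.powSet Cm k)) ∧
        (¬ CayleyWalk.IsDelta (Monoid.exponent G) |Δ| → C1 = ∅ ∧ Cm = ∅)] ∧
    -- in the last condition, "for some `k`" can be replaced by "for any `k`"
    ∀ Δ : ℤ, CayleyWalk.IsDelta (Monoid.exponent G) Δ → 0 < Δ → Δ ≠ 1 →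
      CayleyWalk.IsUnionOfClasses Δ C1 → CayleyWalk.IsUnionOfClasses Δ Cm →
      ((∃ k : (ZMod (Monoid.exponent G))ˣ,
          k ∉ CayleyWalk.H (Monoid.exponent G) Δ ∧ C1 = CayleyWalk.powSet Cm k) ↔
        ∀ k : (ZMod (Monoid.exponent G))ˣ,
          k ∉ CayleyWalk.H (Monoid.exponent G) Δ → C1 = CayleyWalk.powSet Cm k) := by
  refine ⟨?_, fun Δ hΔ _ h1 hU _ => CayleyWalk.exists_powSet_iff_forall hΔ h1 hU⟩
  tfae_have 2 → 1 := fun ⟨t, ht, h⟩ => ⟨1, t, ht, h 1⟩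
  tfae_have 1 → 3 := fun ⟨a, t, ht, h⟩ => by
    obtain ⟨α, hα⟩ := CayleyWalk.transition_eq_smul_one_of_periodicAt
      CayleyWalk.IsNormalMixed.mixedMatrix_mul_right h
    obtain ⟨d, hr, hi⟩ := hC.exists_transformsBy ht hα
    exact hC.satisfiesDeltaCondition hr hi
  tfae_have 3 → 2 := fun h => by
    obtain ⟨d, hd, hr, hi⟩ :=
      CayleyWalk.SatisfiesDeltaCondition.exists_transformsBy (Ci := Ci) (C1 := C1) (Cm := Cm) h
    obtain ⟨t, ht, h⟩ := hC.exists_transition_eq_one hd hr hi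
    exact ⟨t, ht, CayleyWalk.periodicAt_of_transition_eq_one h⟩
  tfae_finish
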